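/- Let $0<p<1$ and $M\ge 3$. For $k\ge1$ let $G_k$ be a graph on $n_k$ units, $n_k\to\infty$, that is a disjoint union of cliques, each of size between $3$ and $M$. Treatments $W_i\in\{0,1\}$ are independent with $\mathbb P(W_i=1)=p$ (a Bernoulli design). For an assignment $w$ let $\nu_i(w)$ be the number and $\rho_i(w)$ the fraction of treated neighbors of unit $i$, and $u_i(w)=(\rho_i(w),\nu_i(w))$. The potential outcomes are $Y_i(w)=w_if_1(i,w)+(1-w_i)f_0(i,w)+\epsilon_i$ with $f_a(i,w)=\alpha_a+\xi_a\rho_i(w)$, where $\alpha_a,\xi_a$ do not depend on $k$; the noise $\epsilon_i$ is square integrable and, conditionally on $W$, has mean zero, is uncorrelated across units and has variance at most a fixed $\sigma^2$ (for instance, i.i.d. $N(0,\sigma^2)$ independent of $W$). One observes $Y_i(W)$, and the estimand is $\tau=\frac1{n_k}\sum_i\mathbb E[Y_i(\mathbf 1)-Y_i(\mathbf 0)]$. For $a\in\{0,1\}$ let $m_a$ be the number of units $i$ with $W_i=a$, and let $U^a$ be the $m_a\times2$ design matrix with rows $u_i(W)-\bar u_a$, where $\bar u_a$ is the mean of $u_i(W)$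 over the arm $\{i:W_i=a\}$. A matrix $X$ with $m$ rows satisfies the $(\kappa;3)$-RE condition over $S$ if $\frac1m\|X\Delta\|_2^2\ge\kappa\|\Delta\|_2^2$ for all $\Delta$ with $\|\Delta_{S^c}\|_1\le3\|\Delta_S\|_1$. Let $y^a$ be the vector of centered observed outcomes of arm $a$, and let $\hat\beta_a$ be any LASSO estimate, i.e. any minimizer of $\frac1{2m_a}\|y^a-U^ab\|_2^2+\lambda_a(m_a)\|b\|_1$, where $\lambda_a(m)>0$, $\lambda_a(m)\to0$ and $\sqrt m\,\lambda_a(m)\to\infty$ as $m\to\infty$. With the fitted intercepts $\hat\alpha_a=\bar Y_a-\hat\beta_a^T\bar u_a$, where $\bar Y_a$ is the mean of $Y_i(W)$ over arm $a$, put $$\hat\tau=\frac1{n_k}\sum_i\big[(\hat\alpha_1+\hat\beta_1^Tu_i(\mathbf 1))-(\hat\alpha_0+\hat\beta_0^Tu_i(\mathbf 0))\big].$$ (i) For every $\delta>0$ there is $\kappa>0$, depending only on $p,M,\delta$, such that if the variance over the units of the size of a unit's clique is at least $\delta$ for all large $k$, then with probability tending to $1$ both $U^0$ and $U^1$ satisfy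 the $(\kappa;3)$-RE condition over $S=\{\rho\}$. (ii) $\hat\tau$ is consistent for $\tau$, i.e. $\hat\tau-\tau\to0$ in probability. If $\alpha_0=\alpha_1$ (in particular, without intercepts in the model), this also holds for $\frac1{n_k}\sum_i(\hat\beta_1^Tu_i(\mathbf 1)-\hat\beta_0^Tu_i(\mathbf 0))$ in place of $\hat\tau$. No condition on the variance of the clique sizes is needed here. (iii) Under the variance condition of (i), both claims of (ii) remain true if each $\hat\beta_a$ is replaced by an ordinary least squares estimate, within arm $a$ and with an intercept, that uses only the features with a nonzero LASSO coefficient in $\hat\beta_a$. -/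

import Mathlib

open MeasureTheory ProbabilityTheory Filter Topology

universe u

noncomputable section

namespace NetExp

/-! ### Graph, features, and potential outcomes -/

/-- `G` is a disjoint union of cliques, each with at least `a` and at most `b` vertices. -/
def IsCliqueUnion {n : ℕ} (G : SimpleGraph (Fin n)) (a b : ℕ) : Prop :=
  ∀ c : G.ConnectedComponent, G.IsClique c.supp ∧ a ≤ c.supp.ncard ∧ c.supp.ncard ≤ b

/-- The size `m_i` of the connected component (here: clique) that contains the unit `i`. -/
def cliqueSize {n : ℕ} (G : SimpleGraph (Fin n)) (i : Fin n) : ℕ :=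
  (G.connectedComponentMk i).supp.ncard

/-- The variance of the clique size over the units,
`(1/n) ∑ i, (m_i - m̄)²` with `m̄ = (1/n) ∑ i, m_i`. -/
def sizeVariance {n : ℕ} (G : SimpleGraph (Fin n)) : ℝ :=
  (∑ i, ((cliqueSize G i : ℝ) - (∑ j, (cliqueSize G j : ℝ)) / n) ^ 2) / n

/-- The number `ν_i` of treated neighbors of `i` under the assignment `w` (`true` = treated). -/
def numTreated {n : ℕ} (G : SimpleGraph (Fin n)) (w : Fin n → Bool) (i : Fin n) : ℕ :=
  {j | G.Adj i j ∧ w j = true}.ncard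

/-- The fraction `ρ_i` of treated neighbors of `i` under the assignment `w`. -/
def fracTreated {n : ℕ} (G : SimpleGraph (Fin n)) (w : Fin n → Bool) (i : Fin n) : ℝ :=
  (numTreated G w i : ℝ) / ((G.neighborSet i).ncard : ℝ)

/-- The feature vector `u_i = (ρ_i, ν_i)`. -/
def feature {n : ℕ} (G : SimpleGraph (Fin n)) (w : Fin n → Bool) (i : Fin n) : Fin 2 → ℝ :=
  ![fracTreated G w i, (numTreated G w i : ℝ)]

/-- The regression functions: `f_a(i, w, G) = α_a + ξ_a ρ_i`, for `a = true` (treatment) and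
`a = false` (control). -/
def regFun (α ξ : Bool → ℝ) {n : ℕ} (G : SimpleGraph (Fin n)) (a : Bool) (w : Fin n → Bool)
    (i : Fin n) : ℝ :=
  α a + ξ a * fracTreated G w i

/-- The potential outcome
`Y_i(w) = w_i f_1(i, w, G) + (1 - w_i) f_0(i, w, G) + ε_i`, for given noise values `e`. -/
def outcome (α ξ : Bool → ℝ) {n : ℕ} (G : SimpleGraph (Fin n)) (e : Fin n → ℝ)
    (w : Fin n → Bool) (i : Fin n) : ℝ :=
  (if w i = true then regFun α ξ G true w i else regFun α ξ G false w i) + e i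

/-! ### The restricted eigenvalue condition, LASSO and least squares -/

section Regression

variable {ι d : Type*} [Fintype ι] [Fintype d]

/-- The restricted eigenvalue condition over `S` with parameters `(κ; α)`, for a matrix whose
rows are the observations. -/
def SatisfiesRE [DecidableEq d] (X : Matrix ι d ℝ) (S : Finset d) (κ α : ℝ) : Prop :=
  ∀ Δ : d → ℝ, ∑ j ∈ Sᶜ, |Δ j| ≤ α * ∑ j ∈ S, |Δ j| →
    κ * ∑ j, Δ j ^ 2 ≤ (1 / (Fintype.card ι : ℝ)) * ∑ i, (X.mulVec Δ i) ^ 2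

/-- The Lagrangian LASSO objective `(1/(2m)) ‖y - X b‖₂² + lam ‖b‖₁`, `m` the number of rows. -/
def lassoObjective (X : Matrix ι d ℝ) (y : ι → ℝ) (lam : ℝ) (b : d → ℝ) : ℝ :=
  (1 / (2 * (Fintype.card ι : ℝ))) * ∑ i, (y i - X.mulVec b i) ^ 2 + lam * ∑ j, |b j|

/-- `b` is a LASSO estimate. -/
def IsLasso (X : Matrix ι d ℝ) (y : ι → ℝ) (lam : ℝ) (b : d → ℝ) : Prop :=
  ∀ b' : d → ℝ, lassoObjective X y lam b ≤ lassoObjective X y lam b'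

/-- `b` is an ordinary least squares estimate using only the columns in `T`. -/
def IsOLSOn (T : Set d) (X : Matrix ι d ℝ) (y : ι → ℝ) (b : d → ℝ) : Prop :=
  (∀ j, j ∉ T → b j = 0) ∧
    ∀ b' : d → ℝ, (∀ j, j ∉ T → b' j = 0) →
      ∑ i, (y i - X.mulVec b i) ^ 2 ≤ ∑ i, (y i - X.mulVec b' i) ^ 2

end Regression

/-! ### Regressions within the two arms -/

/-- The mean of `x` over the units `i` with `w i = a`. -/
def armMean {n : ℕ} (w : Fin n → Bool) (a : Bool) (x : Fin n → ℝ) : ℝ :=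
  (∑ i : {i // w i = a}, x i) / (Fintype.card {i // w i = a} : ℝ)

/-- The centered design matrix of the arm `a` (`U¹` for `a = true`, `U⁰` for `a = false`). -/
def design {n : ℕ} (G : SimpleGraph (Fin n)) (w : Fin n → Bool) (a : Bool) :
    Matrix {i // w i = a} (Fin 2) ℝ :=
  fun i j => feature G w i j - armMean w a (fun i' => feature G w i' j)

/-- The centered responses of the arm `a`. -/
def response {n : ℕ} (w : Fin n → Bool) (a : Bool) (y : Fin n → ℝ) : {i // w i = a} → ℝ :=
  fun i => y i - armMean w a y

/-- The fitted intercept that belongs to the slope vector `b` in the arm `a`. -/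
def intercept {n : ℕ} (G : SimpleGraph (Fin n)) (w : Fin n → Bool) (a : Bool) (y : Fin n → ℝ)
    (b : Fin 2 → ℝ) : ℝ :=
  armMean w a y - ∑ j, b j * armMean w a (fun i => feature G w i j)

/-- The regression estimate of the global average treatment effect,
`(1/n) ∑ i, ((c₁ + b₁ᵀ uᵢ(𝟏)) - (c₀ + b₀ᵀ uᵢ(𝟎)))`, with intercepts `c` and slopes `b`. -/
def gateEstimate {n : ℕ} (G : SimpleGraph (Fin n)) (c : Bool → ℝ) (b : Bool → Fin 2 → ℝ) : ℝ :=
  (∑ i, ((c true + ∑ j, b true j * feature G (fun _ => true) i j) -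
    (c false + ∑ j, b false j * feature G (fun _ => false) i j))) / n

/-! ### The experiment -/

/-- A Bernoulli(`p`) experiment on a finite disjoint union of cliques of sizes between `3` and `M`:
the assignments `W_i` are independent, and each unit is treated with probability `p`. -/
structure Experiment (p : ℝ) (M : ℕ) : Type (u + 1) where
  n : ℕ
  G : SimpleGraph (Fin n)
  cliques : IsCliqueUnion G 3 M
  Ω : Type u
  [mΩ : MeasurableSpace Ω]
  P : Measure Ω
  [isProb : IsProbabilityMeasure P]
  W : Fin n → Ω → Bool
  measurable_W : ∀ i, Measurable (W i)
  indep_W : iIndepFun W P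
  prob_W : ∀ i, P {ω | W i ω = true} = ENNReal.ofReal p

attribute [instance] Experiment.mΩ Experiment.isProb

namespace Experiment

variable {p : ℝ} {M : ℕ}

/-- The realized assignment vector. -/
def assignment (E : Experiment.{u} p M) (ω : E.Ω) : Fin E.n → Bool := fun i => E.W i ω

/-- The σ-algebra generated by the assignment vector. -/
abbrev assignmentSigma (E : Experiment.{u} p M) : MeasurableSpace E.Ω :=
  MeasurableSpace.comap E.assignment inferInstance

/-- Exogenous noise: square integrable, and, conditionally on the assignment vector, centered,
uncorrelated over the units, and of variance at most `σ²`. -/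
structure IsNoise (E : Experiment.{u} p M) (σ : ℝ) (ε : Fin E.n → E.Ω → ℝ) : Prop where
  memLp : ∀ i, MemLp (ε i) 2 E.P
  condMean : ∀ i, (E.P)[ε i | E.assignmentSigma] =ᵐ[E.P] 0
  condUncorrelated : ∀ i j, i ≠ j →
    (E.P)[fun ω => ε i ω * ε j ω | E.assignmentSigma] =ᵐ[E.P] 0
  condVar : ∀ i, (E.P)[fun ω => ε i ω ^ 2 | E.assignmentSigma] ≤ᵐ[E.P] fun _ => σ ^ 2

/-- The global average treatment effect `τ = (1/n) ∑ i, 𝔼[Y_i(𝟏) - Y_i(𝟎)]`. -/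
def gate (E : Experiment.{u} p M) (α ξ : Bool → ℝ) (ε : Fin E.n → E.Ω → ℝ) : ℝ :=
  (∑ i, ∫ ω, (outcome α ξ E.G (fun i' => ε i' ω) (fun _ => true) i
    - outcome α ξ E.G (fun i' => ε i' ω) (fun _ => false) i) ∂E.P) / E.n

/-- The observed outcomes `Y_i(W)`. -/
def observed (E : Experiment.{u} p M) (α ξ : Bool → ℝ) (ε : Fin E.n → E.Ω → ℝ) (ω : E.Ω) :
    Fin E.n → ℝ :=
  outcome α ξ E.G (fun i => ε i ω) (E.assignment ω)

/-- In each arm `a`, `b ω a` is almost surely a LASSO estimate (with an unpenalized intercept)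
of the slopes, with the penalty `lam a m` where `m` is the number of units of the arm. -/
def IsLassoFit (E : Experiment.{u} p M) (α ξ : Bool → ℝ) (ε : Fin E.n → E.Ω → ℝ)
    (lam : Bool → ℕ → ℝ) (b : E.Ω → Bool → Fin 2 → ℝ) : Prop :=
  ∀ᵐ ω ∂E.P, ∀ a : Bool,
    IsLasso (design E.G (E.assignment ω) a)
      (response (E.assignment ω) a (E.observed α ξ ε ω))
      (lam a (Fintype.card {i // E.assignment ω i = a})) (b ω a)

/-- In each arm `a`, `r ω a` is almost surely an ordinary least squares estimate (with an
intercept) of the slopes, using only the features with a nonzero coefficient in `b ω a`. -/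
def IsRefit (E : Experiment.{u} p M) (α ξ : Bool → ℝ) (ε : Fin E.n → E.Ω → ℝ)
    (b r : E.Ω → Bool → Fin 2 → ℝ) : Prop :=
  ∀ᵐ ω ∂E.P, ∀ a : Bool,
    IsOLSOn {j | b ω a j ≠ 0} (design E.G (E.assignment ω) a)
      (response (E.assignment ω) a (E.observed α ξ ε ω)) (r ω a)

/-- `τ̂` from the slopes `b`, with the fitted intercepts included. -/
def tauHat (E : Experiment.{u} p M) (α ξ : Bool → ℝ) (ε : Fin E.n → E.Ω → ℝ)
    (b : E.Ω → Bool → Fin 2 → ℝ) (ω : E.Ω) : ℝ :=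
  gateEstimate E.G
    (fun a => intercept E.G (E.assignment ω) a (E.observed α ξ ε ω) (b ω a)) (b ω)

/-- `τ̂` from the slopes `b` alone, `(1/n) ∑ i, (b₁ᵀ uᵢ(𝟏) - b₀ᵀ uᵢ(𝟎))`. -/
def tauHatSlopes (E : Experiment.{u} p M) (b : E.Ω → Bool → Fin 2 → ℝ) (ω : E.Ω) : ℝ :=
  gateEstimate E.G (fun _ => 0) (b ω)

end Experiment

/-- Along the sequence `E` of experiments, `T k` is consistent for `τ k`: the difference tends to
`0` in probability. -/
def IsConsistent {p : ℝ} {M : ℕ} (E : ℕ → Experiment.{u} p M) (T : ∀ k, (E k).Ω → ℝ)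
    (τ : ℕ → ℝ) : Prop :=
  ∀ η : ℝ, 0 < η → Tendsto (fun k => (E k).P {ω | η ≤ |T k ω - τ k|}) atTop (𝓝 0)

end NetExp

end

open NetExp

/-! Fix an arm and let Δ be the error of a slope vector. The proof rests on two exposure patterns,
each of probability at least min(p, 1-p)^M and independent across cliques: a unit of the arm with no
treated neighbor has feature 0, and one with all of its d neighbors treated has feature (1, d). By
Chebyshev, with high probability each pattern occurs in a fixed fraction of every degree class, up
to few units (`HasRichExposure`). Hence the in-sample mean square V = `meanSq` of Δ controls
`armFit`, the value of Δ at the mean features, through the first pattern. Through the second, it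
controls (`meanContrast` - `armFit`)² + Δ₁² Var(size), up to a small multiple of |Δ|².

Apart from vanishing noise means, `meanContrast` and `armFit` are exactly what enters τ̂ - τ. So a
vanishing V with bounded Δ suffices for consistency (`IsPredictive`), even when ρ and ν cannot be
told apart. For the LASSO both follow from the slow rate, without any eigenvalue condition, since
the penalty dominates the noise (`isPredictive_of_isLassoFit`).

If the sizes vary, the second pattern also bounds Δ₁, and then Δ₀: the feature covariance is
uniformly positive definite (`exists_highProb_le_meanSq`), which is more than RE. The LASSO must
then keep ρ whenever its coefficient is nonzero, so the refit uses a set containing the true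
support, and the basic inequality for least squares applies (`IsPredictive.refit`). -/

noncomputable section

namespace NetExp


/-! ### Cliques -/

section Graph

variable {n : ℕ} {G : SimpleGraph (Fin n)} {M : ℕ}

/-- The number of neighbors of `i`. -/
def nbrCount (G : SimpleGraph (Fin n)) (i : Fin n) : ℕ := (G.neighborSet i).ncard

open Classical in
/-- The vertices in the connected component of `i`. -/
def component (G : SimpleGraph (Fin n)) (i : Fin n) : Finset (Fin n) :=
  Finset.univ.filter fun l => G.connectedComponentMk l = G.connectedComponentMk i

theorem mem_component {i l : Fin n} :
    l ∈ component G i ↔ G.connectedComponentMk l = G.connectedComponentMk i := by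
  simp [component]

theorem coe_component (i : Fin n) :
    (component G i : Set (Fin n)) = (G.connectedComponentMk i).supp := by
  ext l; simp [mem_component, SimpleGraph.ConnectedComponent.mem_supp_iff]

theorem card_component (i : Fin n) : (component G i).card = cliqueSize G i := by
  rw [cliqueSize, ← coe_component, Set.ncard_coe_finset]

theorem disjoint_component {i j : Fin n}
    (h : G.connectedComponentMk j ≠ G.connectedComponentMk i) :
    Disjoint (component G i) (component G j) := by
  rw [Finset.disjoint_left]
  intro l hl hl'
  exact h ((mem_component.1 hl').symm.trans (mem_component.1 hl))

theorem IsCliqueUnion.card_component_le {a b : ℕ} (hG : IsCliqueUnion G a b) (i : Fin n) :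
    (component G i).card ≤ b := by
  rw [card_component]; exact (hG _).2.2

theorem IsCliqueUnion.adj_iff {a b : ℕ} (hG : IsCliqueUnion G a b) {i j : Fin n} :
    G.Adj i j ↔ j ∈ component G i ∧ j ≠ i := by
  constructor
  · intro h
    exact ⟨mem_component.2 (SimpleGraph.ConnectedComponent.sound h.symm.reachable), h.ne'⟩
  · rintro ⟨h, hne⟩
    exact (hG (G.connectedComponentMk i)).1 (by simp) (by
      rw [SimpleGraph.ConnectedComponent.mem_supp_iff]; exact mem_component.1 h) hne.symm

theorem self_mem_component (i : Fin n) : i ∈ component G i := mem_component.2 rfl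

theorem IsCliqueUnion.nbrCount_add_one {a b : ℕ} (hG : IsCliqueUnion G a b) (i : Fin n) :
    nbrCount G i + 1 = cliqueSize G i := by
  have : G.neighborSet i = ((component G i).erase i : Finset (Fin n)) := by
    ext j
    simp [hG.adj_iff, and_comm]
  rw [nbrCount, this, Set.ncard_coe_finset, Finset.card_erase_of_mem (self_mem_component i),
    ← card_component]
  have := Finset.card_pos.2 ⟨i, self_mem_component (G := G) i⟩
  omega

theorem IsCliqueUnion.le_nbrCount (hG : IsCliqueUnion G 3 M) (i : Fin n) : 2 ≤ nbrCount G i := by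
  have h := hG.nbrCount_add_one i
  have h2 : 3 ≤ cliqueSize G i := (hG _).2.1
  omega

theorem IsCliqueUnion.nbrCount_le {a : ℕ} (hG : IsCliqueUnion G a M) (i : Fin n) :
    nbrCount G i ≤ M := by
  have h := hG.nbrCount_add_one i
  have h2 : cliqueSize G i ≤ M := (hG _).2.2
  omega

theorem numTreated_le (w : Fin n → Bool) (i : Fin n) : numTreated G w i ≤ nbrCount G i :=
  Set.ncard_le_ncard (fun _ h => h.1) (Set.toFinite _)

theorem fracTreated_nonneg (w : Fin n → Bool) (i : Fin n) : 0 ≤ fracTreated G w i :=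
  div_nonneg (Nat.cast_nonneg _) (Nat.cast_nonneg _)

theorem fracTreated_le (w : Fin n → Bool) (i : Fin n) : fracTreated G w i ≤ 1 :=
  div_le_one_of_le₀ (by exact_mod_cast numTreated_le w i) (Nat.cast_nonneg _)

theorem IsCliqueUnion.abs_feature_le (hG : IsCliqueUnion G 3 M) (w : Fin n → Bool) (i : Fin n)
    (j : Fin 2) : |feature G w i j| ≤ M := by
  have h1 : (numTreated G w i : ℝ) ≤ M := by
    exact_mod_cast (numTreated_le w i).trans (hG.nbrCount_le i)
  have h2 : (1 : ℝ) ≤ M := by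
    exact_mod_cast (show 1 ≤ M by have := hG.le_nbrCount i; have := hG.nbrCount_le i; omega)
  fin_cases j
  · simpa [feature, abs_of_nonneg (fracTreated_nonneg w i)] using (fracTreated_le w i).trans h2
  · simpa [feature] using h1

/-- The unit `i` is in the arm `a`, and all its neighbors are in the arm `b`. -/
def HasExposure (G : SimpleGraph (Fin n)) (a b : Bool) (i : Fin n) (w : Fin n → Bool) : Prop :=
  w i = a ∧ ∀ j, G.Adj i j → w j = b

/-- Since neighborhoods are cliques, the pattern fixes the assignment on one component and nothing
else; this is what makes its probability a product and separate cliques independent. -/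
theorem IsCliqueUnion.hasExposure_iff {c d : ℕ} (hG : IsCliqueUnion G c d) {a b : Bool}
    {i : Fin n} {w : Fin n → Bool} :
    HasExposure G a b i w ↔ ∀ l ∈ component G i, w l = if l = i then a else b := by
  constructor
  · rintro ⟨h1, h2⟩ l hl
    split_ifs with h
    · rw [h, h1]
    · exact h2 l (hG.adj_iff.2 ⟨hl, h⟩)
  · intro h
    refine ⟨by simpa using h i (self_mem_component i), fun j hj => ?_⟩
    obtain ⟨h3, h4⟩ := hG.adj_iff.1 hj
    simpa [h4] using h j h3

theorem IsCliqueUnion.feature_of_hasExposure (hG : IsCliqueUnion G 3 M) {a b : Bool} {i : Fin n}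
    {w : Fin n → Bool} (h : HasExposure G a b i w) :
    feature G w i = if b = true then ![1, (nbrCount G i : ℝ)] else 0 := by
  have hpos : (nbrCount G i : ℝ) ≠ 0 := by
    have := hG.le_nbrCount i
    positivity
  cases b
  · have h0 : numTreated G w i = 0 := by
      rw [numTreated, Set.ncard_eq_zero]
      ext j
      simp only [Set.mem_ofPred_eq, Set.mem_empty_iff_false, iff_false, not_and]
      intro hj
      simp [h.2 j hj]
    ext j
    fin_cases j <;> simp [feature, fracTreated, h0]
  · have h0 : numTreated G w i = nbrCount G i := by
      rw [numTreated, nbrCount]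
      congr 1
      ext j
      simp only [Set.mem_ofPred_eq, SimpleGraph.mem_neighborSet, and_iff_left_iff_imp]
      exact fun hj => h.2 j hj
    have h1 : fracTreated G w i = 1 := by
      rw [fracTreated, h0]; exact div_self hpos
    simp [feature, h1, h0]

theorem IsCliqueUnion.feature_const (hG : IsCliqueUnion G 3 M) (b : Bool) (i : Fin n) :
    feature G (fun _ => b) i = if b = true then ![1, (nbrCount G i : ℝ)] else 0 :=
  hG.feature_of_hasExposure (a := b) ⟨rfl, fun _ _ => rfl⟩

end Graph

/-! ### Second moment bounds -/

section SecondMoment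

variable {Ω : Type*} [MeasurableSpace Ω] {P : Measure Ω}
  {ι : Type*} [Fintype ι]

open Classical in
/-- Chebyshev's inequality for a sum of square integrable variables such that each of them
correlates with at most `N` others. -/
theorem measureReal_le_abs_sum_le (f : ι → Ω → ℝ) (hf : ∀ i, MemLp (f i) 2 P)
    (S : ι → Finset ι) {C : ℝ} (hC : 0 ≤ C) {N : ℕ} (hN : ∀ i, (S i).card ≤ N)
    (h0 : ∀ i, ∀ j ∉ S i, ∫ ω, f i ω * f j ω ∂P = 0)
    (h1 : ∀ i, ∀ j ∈ S i, ∫ ω, f i ω * f j ω ∂P ≤ C) {t : ℝ} (ht : 0 < t) :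
    P.real {ω | t ≤ |∑ i, f i ω|} ≤ C * N * Fintype.card ι / t ^ 2 := by
  have hint : ∀ i j, Integrable (fun ω => f i ω * f j ω) P := fun i j =>
    (hf i).integrable_mul (hf j)
  have hsq : ∀ ω, (∑ i, f i ω) ^ 2 = ∑ i, ∑ j, f i ω * f j ω := fun ω => by
    rw [sq, Finset.sum_mul_sum]
  have hI : Integrable (fun ω => (∑ i, f i ω) ^ 2) P := by
    simp_rw [hsq]
    exact integrable_finsetSum _ fun i _ => integrable_finsetSum _ fun j _ => hint i j
  have hbound : ∫ ω, (∑ i, f i ω) ^ 2 ∂P ≤ C * N * Fintype.card ι := by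
    simp_rw [hsq]
    rw [integral_finsetSum _ fun i _ => integrable_finsetSum _ fun j _ => hint i j]
    calc ∑ i, ∫ ω, ∑ j, f i ω * f j ω ∂P ≤ ∑ _i : ι, C * N := by
          refine Finset.sum_le_sum fun i _ => ?_
          rw [integral_finsetSum _ fun j _ => hint i j,
            ← Finset.sum_subset (Finset.subset_univ (S i)) fun j _ hj => h0 i j hj]
          calc ∑ j ∈ S i, ∫ ω, f i ω * f j ω ∂P ≤ ∑ _j ∈ S i, C := Finset.sum_le_sum (h1 i)
            _ = C * (S i).card := by rw [Finset.sum_const, nsmul_eq_mul, mul_comm]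
            _ ≤ C * N := by
              have : ((S i).card : ℝ) ≤ N := by exact_mod_cast hN i
              gcongr
      _ = _ := by
          rw [Finset.sum_const, nsmul_eq_mul, mul_comm, Finset.card_univ]
  have hset : {ω | t ≤ |∑ i, f i ω|} = {ω | t ^ 2 ≤ (∑ i, f i ω) ^ 2} := by
    ext ω
    simp only [Set.mem_ofPred_eq]
    rw [sq_le_sq, abs_of_pos ht]
  rw [hset, le_div_iff₀ (by positivity), mul_comm]
  exact (mul_meas_ge_le_integral_of_nonneg (ae_of_all _ fun ω => sq_nonneg _) hI _).trans hbound

end SecondMoment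

/-! ### Exposure probabilities and noise sums in a single experiment. -/

namespace Experiment

variable {p : ℝ} {M : ℕ} (E : Experiment.{u} p M)

theorem measurable_assignment : Measurable E.assignment :=
  measurable_pi_lambda _ E.measurable_W

theorem prob_W_eq (hp0 : 0 ≤ p) (i : Fin E.n) (a : Bool) :
    E.P (E.W i ⁻¹' {a}) = ENNReal.ofReal (if a = true then p else 1 - p) := by
  have h : E.P (E.W i ⁻¹' {true}) = ENNReal.ofReal p := E.prob_W i
  cases a
  · have hc : E.W i ⁻¹' {false} = (E.W i ⁻¹' {true})ᶜ := by
      ext ω; simp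
    rw [hc, prob_compl_eq_one_sub (E.measurable_W i (measurableSet_singleton _)), h,
      ← ENNReal.ofReal_one, ← ENNReal.ofReal_sub _ hp0]
    simp
  · simpa using h

/-- The event that `i` is in the arm `a` and its neighbors are in the arm `b`. -/
def exposureEvent (a b : Bool) (i : Fin E.n) : Set E.Ω :=
  {ω | HasExposure E.G a b i (E.assignment ω)}

theorem exposureEvent_eq (a b : Bool) (i : Fin E.n) :
    E.exposureEvent a b i =
      ⋂ l ∈ component E.G i, E.W l ⁻¹' {if l = i then a else b} := by
  ext ω
  simp only [exposureEvent, Set.mem_ofPred_eq, E.cliques.hasExposure_iff, Set.mem_iInter,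
    Set.mem_preimage, Set.mem_singleton_iff]
  rfl

theorem measurableSet_exposureEvent (a b : Bool) (i : Fin E.n) :
    MeasurableSet (E.exposureEvent a b i) := by
  rw [exposureEvent_eq]
  exact Finset.measurableSet_biInter _ fun l _ => E.measurable_W l (measurableSet_singleton _)

theorem measure_exposureEvent (a b : Bool) (i : Fin E.n) :
    E.P (E.exposureEvent a b i) =
      ∏ l ∈ component E.G i, E.P (E.W l ⁻¹' {if l = i then a else b}) := by
  rw [exposureEvent_eq]
  exact E.indep_W.measure_inter_preimage_eq_mul _ fun l _ => measurableSet_singleton _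

theorem measure_exposureEvent_inter (a b : Bool) {i j : Fin E.n} (hij : j ∉ component E.G i) :
    E.P (E.exposureEvent a b i ∩ E.exposureEvent a b j) =
      E.P (E.exposureEvent a b i) * E.P (E.exposureEvent a b j) := by
  classical
  rw [mem_component] at hij
  have hd := disjoint_component hij
  -- The two patterns live on disjoint components, so they glue to one pattern on the union, and
  -- independence is applied once to that union.
  set c : Fin E.n → Bool := fun l =>
    if l ∈ component E.G i then (if l = i then a else b) else (if l = j then a else b) with hc
  have hci : ∀ l ∈ component E.G i, c l = if l = i then a else b := fun l hl => by
    simp [hc, hl]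
  have hcj : ∀ l ∈ component E.G j, c l = if l = j then a else b := fun l hl => by
    simp [hc, Finset.disjoint_right.1 hd hl]
  have hinter : E.exposureEvent a b i ∩ E.exposureEvent a b j =
      ⋂ l ∈ component E.G i ∪ component E.G j, E.W l ⁻¹' {c l} := by
    have hunion : ∀ S : Fin E.n → Set E.Ω, ⋂ l ∈ component E.G i ∪ component E.G j, S l =
        (⋂ l ∈ component E.G i, S l) ∩ ⋂ l ∈ component E.G j, S l := fun S => by
      ext ω; simp [or_imp, forall_and]
    rw [exposureEvent_eq, exposureEvent_eq, hunion]
    congr 1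
    · exact Set.iInter₂_congr fun l hl => by rw [hci l hl]
    · exact Set.iInter₂_congr fun l hl => by rw [hcj l hl]
  rw [hinter, E.indep_W.measure_inter_preimage_eq_mul _ fun l _ => measurableSet_singleton _,
    Finset.prod_union hd, measure_exposureEvent, measure_exposureEvent]
  congr 1
  · exact Finset.prod_congr rfl fun l hl => by rw [hci l hl]
  · exact Finset.prod_congr rfl fun l hl => by rw [hcj l hl]

/-- The probability is a product of at most M factors, each p or 1 - p. -/
theorem le_measureReal_exposureEvent (hp0 : 0 < p) (hp1 : p < 1) (a b : Bool) (i : Fin E.n) :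
    min p (1 - p) ^ M ≤ E.P.real (E.exposureEvent a b i) := by
  have hc0 : 0 ≤ min p (1 - p) := le_min hp0.le (by linarith)
  have hc1 : min p (1 - p) ≤ 1 := (min_le_left _ _).trans hp1.le
  rw [measureReal_def, measure_exposureEvent, ENNReal.toReal_prod]
  calc min p (1 - p) ^ M ≤ min p (1 - p) ^ (component E.G i).card :=
        pow_le_pow_of_le_one hc0 hc1 (E.cliques.card_component_le i)
    _ = ∏ _l ∈ component E.G i, min p (1 - p) := by rw [Finset.prod_const]
    _ ≤ _ := by
      refine Finset.prod_le_prod (fun _ _ => hc0) fun l _ => ?_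
      rw [E.prob_W_eq hp0.le]
      cases (if l = i then a else b)
      · simp [ENNReal.toReal_ofReal (sub_nonneg.2 hp1.le)]
      · simp [ENNReal.toReal_ofReal hp0.le]

open Classical in
/-- The number of units of degree `s` that are in the arm `a` and have all neighbors in the
arm `b` falls short of its expectation by a fixed fraction of `n` only with small probability. -/
theorem measureReal_exposure_count_le (hp0 : 0 < p) (hp1 : p < 1) (a b : Bool) (s : ℕ)
    {η : ℝ} (hη : 0 < η) (hn : 0 < E.n) :
    E.P.real {ω | ¬ (min p (1 - p) ^ M * (Finset.univ.filter fun i => nbrCount E.G i = s).card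
        - η * E.n ≤ (Finset.univ.filter fun i => nbrCount E.G i = s ∧
            HasExposure E.G a b i (E.assignment ω)).card)} ≤ M / (η ^ 2 * E.n) := by
  set A := E.exposureEvent a b with hA
  have hAm : ∀ i, MeasurableSet (A i) := E.measurableSet_exposureEvent a b
  -- Centered indicators, set to zero outside the degree class; they are uncorrelated across
  -- cliques, so each has nonzero covariance with at most M of them.
  set f : Fin E.n → E.Ω → ℝ := fun i ω => if nbrCount E.G i = s then
    (A i).indicator (fun _ => (1 : ℝ)) ω - E.P.real (A i) else 0 with hf
  have hind : ∀ i, Integrable ((A i).indicator fun _ => (1 : ℝ)) E.P := fun i =>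
    (integrable_const _).indicator (hAm i)
  have hfb : ∀ i ω, |f i ω| ≤ 1 := fun i ω => by
    simp only [hf]
    have h0 : 0 ≤ E.P.real (A i) := measureReal_nonneg
    have h1 : E.P.real (A i) ≤ 1 := measureReal_le_one
    split_ifs
    · by_cases hω : ω ∈ A i
      · rw [Set.indicator_of_mem hω, abs_le]; constructor <;> linarith
      · rw [Set.indicator_of_notMem hω, abs_le]; constructor <;> linarith
    · simp
  have hfm : ∀ i, Measurable (f i) := fun i => by
    simp only [hf]
    split_ifs
    · exact (measurable_const.indicator (hAm i)).sub_const _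
    · exact measurable_const
  have hfL : ∀ i, MemLp (f i) 2 E.P := fun i =>
    MemLp.of_bound (hfm i).aestronglyMeasurable 1 (ae_of_all _ fun ω => hfb i ω)
  have h0 : ∀ i, ∀ j ∉ component E.G i, ∫ ω, f i ω * f j ω ∂E.P = 0 := fun i j hij => by
    by_cases hi : nbrCount E.G i = s
    swap
    · simp [hf, hi]
    by_cases hj : nbrCount E.G j = s
    swap
    · simp [hf, hj]
    have hexp : ∀ ω, f i ω * f j ω = (A i ∩ A j).indicator (fun _ => (1 : ℝ)) ω
        - E.P.real (A j) * (A i).indicator (fun _ => (1 : ℝ)) ω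
        - E.P.real (A i) * (A j).indicator (fun _ => (1 : ℝ)) ω
        + E.P.real (A i) * E.P.real (A j) := fun ω => by
      simp only [hf, hi, hj, if_true]
      by_cases h1 : ω ∈ A i <;> by_cases h2 : ω ∈ A j <;> simp [h1, h2] <;> ring
    have hm : E.P.real (A i ∩ A j) = E.P.real (A i) * E.P.real (A j) := by
      rw [measureReal_def, hA, E.measure_exposureEvent_inter a b hij, ENNReal.toReal_mul]
      rfl
    have hI1 : Integrable ((A i ∩ A j).indicator fun _ => (1 : ℝ)) E.P :=
      (integrable_const _).indicator ((hAm i).inter (hAm j))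
    have hI2 := (hind i).const_mul (E.P.real (A j))
    have hI3 := (hind j).const_mul (E.P.real (A i))
    calc ∫ ω, f i ω * f j ω ∂E.P = ∫ ω, ((A i ∩ A j).indicator (fun _ => (1 : ℝ)) ω
          - E.P.real (A j) * (A i).indicator (fun _ => (1 : ℝ)) ω
          - E.P.real (A i) * (A j).indicator (fun _ => (1 : ℝ)) ω
          + E.P.real (A i) * E.P.real (A j)) ∂E.P := by simp_rw [hexp]
      _ = ∫ ω, (A i ∩ A j).indicator (fun _ => (1 : ℝ)) ω ∂E.P
          - ∫ ω, E.P.real (A j) * (A i).indicator (fun _ => (1 : ℝ)) ω ∂E.P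
          - ∫ ω, E.P.real (A i) * (A j).indicator (fun _ => (1 : ℝ)) ω ∂E.P
          + ∫ _ω, E.P.real (A i) * E.P.real (A j) ∂E.P := by
          have hI4 : Integrable (fun ω => (A i ∩ A j).indicator (fun _ => (1 : ℝ)) ω
            - E.P.real (A j) * (A i).indicator (fun _ => (1 : ℝ)) ω) E.P := hI1.sub hI2
          have hI5 : Integrable (fun ω => (A i ∩ A j).indicator (fun _ => (1 : ℝ)) ω
            - E.P.real (A j) * (A i).indicator (fun _ => (1 : ℝ)) ω
            - E.P.real (A i) * (A j).indicator (fun _ => (1 : ℝ)) ω) E.P := hI4.sub hI3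
          rw [integral_add hI5 (integrable_const _), integral_sub hI4 hI3, integral_sub hI1 hI2]
      _ = 0 := by
          rw [integral_const_mul, integral_const_mul, integral_indicator_const _ (hAm i),
            integral_indicator_const _ (hAm j),
            integral_indicator_const _ ((hAm i).inter (hAm j)), hm]
          simp
          ring
  have h1 : ∀ i, ∀ j ∈ component E.G i, ∫ ω, f i ω * f j ω ∂E.P ≤ 1 := fun i j _ => by
    calc ∫ ω, f i ω * f j ω ∂E.P ≤ ∫ _ω, (1 : ℝ) ∂E.P := by
          refine integral_mono ((hfL i).integrable_mul (hfL j)) (integrable_const _) fun ω => ?_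
          calc f i ω * f j ω ≤ |f i ω * f j ω| := le_abs_self _
            _ = |f i ω| * |f j ω| := abs_mul _ _
            _ ≤ 1 := mul_le_one₀ (hfb i ω) (abs_nonneg _) (hfb j ω)
      _ = 1 := by simp
  have hn' : (0 : ℝ) < E.n := by exact_mod_cast hn
  have key := measureReal_le_abs_sum_le f hfL (component E.G) zero_le_one
    (E.cliques.card_component_le) h0 h1 (mul_pos hη hn')
  refine (measureReal_mono ?_).trans (key.trans_eq ?_)
  · intro ω hω
    simp only [Set.mem_ofPred_eq, not_le] at hω ⊢
    have hsum : ∑ i, f i ω = ((Finset.univ.filter fun i => nbrCount E.G i = s ∧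
            HasExposure E.G a b i (E.assignment ω)).card : ℝ)
        - ∑ i ∈ Finset.univ.filter (fun i => nbrCount E.G i = s), E.P.real (A i) := by
      rw [Finset.sum_filter, Finset.card_eq_sum_ones, Nat.cast_sum, Finset.sum_filter,
        ← Finset.sum_sub_distrib]
      refine Finset.sum_congr rfl fun i _ => ?_
      have hiff : ω ∈ A i ↔ HasExposure E.G a b i (E.assignment ω) := Iff.rfl
      by_cases hi : nbrCount E.G i = s <;> by_cases hω : ω ∈ A i <;>
        simp [hf, hi, hω, ← hiff]
    have hlow : min p (1 - p) ^ M * (Finset.univ.filter fun i => nbrCount E.G i = s).card ≤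
        ∑ i ∈ Finset.univ.filter (fun i => nbrCount E.G i = s), E.P.real (A i) := by
      rw [mul_comm, ← nsmul_eq_mul]
      exact Finset.card_nsmul_le_sum _ _ _ fun i _ => E.le_measureReal_exposureEvent hp0 hp1 a b i
    rw [hsum, abs_sub_comm]
    refine le_trans ?_ (le_abs_self _)
    linarith
  · rw [Fintype.card_fin]
    field_simp

/-- A sum of noise terms, with bounded weights that depend on the assignment, is at most of the
order of `√n`. -/
theorem IsNoise.measureReal_le {σ : ℝ} {ε : Fin E.n → E.Ω → ℝ} (hε : E.IsNoise σ ε)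
    (c : Fin E.n → (Fin E.n → Bool) → ℝ) {B : ℝ} (hB : 0 ≤ B) (hc : ∀ i w, |c i w| ≤ B)
    {t : ℝ} (ht : 0 < t) :
    E.P.real {ω | t ≤ |∑ i, c i (E.assignment ω) * ε i ω|} ≤ B ^ 2 * σ ^ 2 * E.n / t ^ 2 := by
  classical
  have hm : E.assignmentSigma ≤ E.mΩ := E.measurable_assignment.comap_le
  have hcm : ∀ g : (Fin E.n → Bool) → ℝ,
      StronglyMeasurable[E.assignmentSigma] fun ω => g (E.assignment ω) := fun g =>
    ((measurable_of_countable g).comp (comap_measurable E.assignment)).stronglyMeasurable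
  have hcm' : ∀ g : (Fin E.n → Bool) → ℝ, Measurable fun ω => g (E.assignment ω) := fun g =>
    (measurable_of_countable g).comp E.measurable_assignment
  have hL : ∀ i, MemLp (fun ω => c i (E.assignment ω) * ε i ω) 2 E.P := fun i =>
    (hε.memLp i).of_le_mul (c := B)
      ((hcm' (c i)).aestronglyMeasurable.mul (hε.memLp i).aestronglyMeasurable)
      (ae_of_all _ fun ω => by
        rw [norm_mul]; gcongr; exact hc i _)
  have hint : ∀ i j, Integrable (fun ω => ε i ω * ε j ω) E.P := fun i j =>
    (hε.memLp i).integrable_mul (hε.memLp j)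
  have h0 : ∀ i, ∀ j ∉ ({i} : Finset (Fin E.n)),
      ∫ ω, (c i (E.assignment ω) * ε i ω) * (c j (E.assignment ω) * ε j ω) ∂E.P = 0 := by
    intro i j hij
    have hij : i ≠ j := fun h => hij (by simp [h])
    -- The weights are bounded functions of the assignment, so they come out of the conditional
    -- expectation, and what is left is the conditional covariance of the noise.
    have e1 := condExp_stronglyMeasurable_mul_of_bound hm (hcm fun w => c i w * c j w) (hint i j)
      (B * B) (ae_of_all _ fun ω => by
        rw [norm_mul]; gcongr
        · exact hc i _
        · exact hc j _)
    calc _ = ∫ ω, ((fun ω => c i (E.assignment ω) * c j (E.assignment ω)) *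
          fun ω => ε i ω * ε j ω) ω ∂E.P := by
          refine integral_congr_ae (ae_of_all _ fun ω => ?_)
          simp only [Pi.mul_apply]; ring
      _ = ∫ ω, (0 : ℝ) ∂E.P := by
          rw [← integral_condExp hm]
          refine integral_congr_ae ?_
          filter_upwards [e1, hε.condUncorrelated i j hij] with ω h1 h2
          rw [h1, Pi.mul_apply, h2]
          simp
      _ = 0 := by simp
  have h1 : ∀ i, ∀ j ∈ ({i} : Finset (Fin E.n)),
      ∫ ω, (c i (E.assignment ω) * ε i ω) * (c j (E.assignment ω) * ε j ω) ∂E.P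
        ≤ B ^ 2 * σ ^ 2 := by
    intro i j hij
    rw [Finset.mem_singleton] at hij
    subst hij
    have hint2 : Integrable (fun ω => ε j ω ^ 2) E.P := (hε.memLp j).integrable_sq
    calc _ ≤ ∫ ω, B ^ 2 * ε j ω ^ 2 ∂E.P := by
          refine integral_mono ((hL j).integrable_mul (hL j)) (hint2.const_mul _) fun ω => ?_
          have : c j (E.assignment ω) ^ 2 ≤ B ^ 2 := sq_le_sq' (abs_le.1 (hc j _)).1
            (abs_le.1 (hc j _)).2
          calc _ = c j (E.assignment ω) ^ 2 * ε j ω ^ 2 := by ring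
            _ ≤ _ := by gcongr
      _ = B ^ 2 * ∫ ω, ε j ω ^ 2 ∂E.P := integral_const_mul _ _
      _ ≤ B ^ 2 * σ ^ 2 := by
          gcongr
          rw [← integral_condExp hm]
          calc _ ≤ ∫ _ω, σ ^ 2 ∂E.P :=
                integral_mono_ae integrable_condExp (integrable_const _) (hε.condVar j)
            _ = σ ^ 2 := by simp
  have key := measureReal_le_abs_sum_le _ hL (fun i => {i}) (by positivity : 0 ≤ B ^ 2 * σ ^ 2)
    (N := 1) (fun i => by simp) h0 h1 ht
  simpa using key

end Experiment


/-! ### LASSO and least squares -/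

section Regression

variable {ι d : Type*} [Fintype ι] [Fintype d]

/-- The in-sample mean squared value of the linear function with slopes `Δ`. -/
def meanSq (X : Matrix ι d ℝ) (Δ : d → ℝ) : ℝ :=
  (1 / (Fintype.card ι : ℝ)) * ∑ i, (X.mulVec Δ i) ^ 2

theorem meanSq_nonneg (X : Matrix ι d ℝ) (Δ : d → ℝ) : 0 ≤ meanSq X Δ := by
  unfold meanSq; positivity

variable {X : Matrix ι d ℝ} {y r : ι → ℝ} {β b : d → ℝ}

/-- Expansion of the square of r - X(b - β). The noise enters only through its inner products with
the columns, which is all that the LASSO and least squares bounds need. -/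
theorem sum_sq_residual_sub (hy : ∀ i, y i = X.mulVec β i + r i) :
    ∑ i, (y i - X.mulVec b i) ^ 2 - ∑ i, (y i - X.mulVec β i) ^ 2 =
      ∑ i, (X.mulVec (b - β) i) ^ 2 - 2 * ∑ j, (b j - β j) * ∑ i, X i j * r i := by
  have h : ∑ j, (b j - β j) * ∑ i, X i j * r i = ∑ i, r i * X.mulVec (b - β) i := by
    simp_rw [Finset.mul_sum, Matrix.mulVec, dotProduct, Finset.mul_sum]
    rw [Finset.sum_comm]
    refine Finset.sum_congr rfl fun i _ => Finset.sum_congr rfl fun j _ => ?_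
    rw [Pi.sub_apply]; ring
  rw [h, Finset.mul_sum, ← Finset.sum_sub_distrib, ← Finset.sum_sub_distrib]
  refine Finset.sum_congr rfl fun i _ => ?_
  rw [hy i, Matrix.mulVec_sub, Pi.sub_apply]
  ring

theorem sum_mul_le_of_abs_le {Δ g : d → ℝ} {t : ℝ} (h : ∀ j, |g j| ≤ t) :
    ∑ j, Δ j * g j ≤ t * ∑ j, |Δ j| := by
  rw [Finset.mul_sum]
  refine Finset.sum_le_sum fun j _ => ?_
  calc Δ j * g j ≤ |Δ j * g j| := le_abs_self _
    _ = |g j| * |Δ j| := by rw [abs_mul, mul_comm]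
    _ ≤ t * |Δ j| := by gcongr; exact h j

/-- The slow rate bounds for the LASSO. -/
theorem IsLasso.bounds {lam : ℝ} (hb : IsLasso X y lam b) (hlam : 0 < lam)
    (hm : 0 < Fintype.card ι) (hy : ∀ i, y i = X.mulVec β i + r i)
    (hr : ∀ j, |∑ i, X i j * r i| ≤ Fintype.card ι * lam / 2) :
    meanSq X (b - β) ≤ 3 * lam * ∑ j, |β j| ∧ ∑ j, |b j| ≤ 3 * ∑ j, |β j| := by
  have hm' : (0 : ℝ) < Fintype.card ι := by exact_mod_cast hm
  have h1 := hb β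
  have h2 := sum_sq_residual_sub (b := b) hy
  have h3 := sum_mul_le_of_abs_le (Δ := fun j => b j - β j) hr
  have h4 : ∑ j, |b j - β j| ≤ ∑ j, |b j| + ∑ j, |β j| := by
    rw [← Finset.sum_add_distrib]
    exact Finset.sum_le_sum fun j _ => abs_sub _ _
  unfold lassoObjective at h1
  have hsq : 0 ≤ ∑ i, (X.mulVec (b - β) i) ^ 2 := Finset.sum_nonneg fun i _ => sq_nonneg _
  -- Optimality gives 2mλ(‖β‖₁ - ‖b‖₁) and the noise adds at most mλ(‖b‖₁ + ‖β‖₁). Both conclusions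
  -- are read off from the sum: drop ‖b‖₁, or use that the left side is nonnegative.
  have h5 : ∑ i, (X.mulVec (b - β) i) ^ 2 ≤
      Fintype.card ι * lam * (3 * ∑ j, |β j| - ∑ j, |b j|) := by
    have h6 : ∑ i, (y i - X.mulVec b i) ^ 2 - ∑ i, (y i - X.mulVec β i) ^ 2 ≤
        2 * Fintype.card ι * lam * (∑ j, |β j| - ∑ j, |b j|) := by
      have h7 : (1 / (2 * (Fintype.card ι : ℝ))) *
          (∑ i, (y i - X.mulVec b i) ^ 2 - ∑ i, (y i - X.mulVec β i) ^ 2) ≤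
          lam * (∑ j, |β j| - ∑ j, |b j|) := by linarith
      rw [one_div, inv_mul_le_iff₀ (by positivity)] at h7
      linarith
    have h8 : Fintype.card ι * lam / 2 * ∑ j, |b j - β j| ≤
        Fintype.card ι * lam / 2 * (∑ j, |b j| + ∑ j, |β j|) := by gcongr
    linarith
  constructor
  · unfold meanSq
    rw [one_div, inv_mul_le_iff₀ hm']
    have : 0 ≤ Fintype.card ι * lam * ∑ j, |b j| :=
      mul_nonneg (by positivity) (Finset.sum_nonneg fun j _ => abs_nonneg _)
    linarith
  · have h9 := hsq.trans h5
    have := nonneg_of_mul_nonneg_right h9 (by positivity)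
    linarith

/-- The basic inequality for least squares on a set of columns that contains the true support. -/
theorem IsOLSOn.meanSq_le {T : Set d} (hb : IsOLSOn T X y b) (hβ : ∀ j, j ∉ T → β j = 0)
    (hm : 0 < Fintype.card ι) (hy : ∀ i, y i = X.mulVec β i + r i) {γ : ℝ}
    (hr : ∀ j, |∑ i, X i j * r i| ≤ γ * Fintype.card ι) :
    meanSq X (b - β) ≤ 2 * γ * ∑ j, |b j - β j| := by
  have hm' : (0 : ℝ) < Fintype.card ι := by exact_mod_cast hm
  have h1 := hb.2 β hβ
  have h2 := sum_sq_residual_sub (b := b) hy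
  have h3 := sum_mul_le_of_abs_le (Δ := fun j => b j - β j) hr
  unfold meanSq
  rw [one_div, inv_mul_le_iff₀ hm']
  linarith

end Regression

/-! ### Regressions within an arm -/

section Arm

variable {n : ℕ} {G : SimpleGraph (Fin n)} {M : ℕ} {w : Fin n → Bool} {a : Bool}

/-- The number of units in the arm `a`. -/
abbrev armCard (w : Fin n → Bool) (a : Bool) : ℕ := Fintype.card {i // w i = a}

theorem armCard_le (w : Fin n → Bool) (a : Bool) : armCard w a ≤ n := by
  simpa using Fintype.card_subtype_le fun i => w i = a

theorem sum_arm (x : Fin n → ℝ) :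
    ∑ i : {i // w i = a}, x i = ∑ i, if w i = a then x i else 0 := by
  rw [← Finset.sum_filter]
  exact (Finset.sum_subtype (Finset.univ.filter fun i => w i = a) (by simp) x).symm

theorem abs_armMean_le {x : Fin n → ℝ} {B : ℝ} (hB : 0 ≤ B) (hx : ∀ i, |x i| ≤ B) :
    |armMean w a x| ≤ B := by
  rw [armMean, abs_div, Nat.abs_cast]
  refine div_le_of_le_mul₀ (Nat.cast_nonneg _) hB ?_
  calc |∑ i : {i // w i = a}, x i| ≤ ∑ i : {i // w i = a}, |x i| :=
        Finset.abs_sum_le_sum_abs _ _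
    _ ≤ ∑ _i : {i // w i = a}, B := Finset.sum_le_sum fun i _ => hx i
    _ = _ := by rw [Finset.sum_const, nsmul_eq_mul, mul_comm, Finset.card_univ]

theorem armMean_mul_card (hm : 0 < armCard w a) (x : Fin n → ℝ) :
    armMean w a x * armCard w a = ∑ i : {i // w i = a}, x i :=
  div_mul_cancel₀ _ (by exact_mod_cast hm.ne')

theorem sum_sub_armMean (hm : 0 < armCard w a) (x : Fin n → ℝ) :
    ∑ i : {i // w i = a}, (x i - armMean w a x) = 0 := by
  rw [Finset.sum_sub_distrib, Finset.sum_const, Finset.card_univ, nsmul_eq_mul, mul_comm,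
    armMean_mul_card hm, sub_self]

/-- The value at the mean features of the arm of the linear function with slopes `Δ`. -/
def armFit (G : SimpleGraph (Fin n)) (w : Fin n → Bool) (a : Bool) (Δ : Fin 2 → ℝ) : ℝ :=
  ∑ j, Δ j * armMean w a (fun i => feature G w i j)

theorem design_mulVec (Δ : Fin 2 → ℝ) (i : {i // w i = a}) :
    (design G w a).mulVec Δ i = ∑ j, Δ j * feature G w i j - armFit G w a Δ := by
  simp only [design, armFit, Matrix.mulVec, dotProduct]
  rw [← Finset.sum_sub_distrib]
  exact Finset.sum_congr rfl fun j _ => by ring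

theorem armFit_sq_le (hG : IsCliqueUnion G 3 M) (w : Fin n → Bool) (a : Bool) (Δ : Fin 2 → ℝ) :
    armFit G w a Δ ^ 2 ≤ 2 * M ^ 2 * ∑ j, Δ j ^ 2 := by
  have h : ∀ j, armMean w a (fun i => feature G w i j) ^ 2 ≤ (M : ℝ) ^ 2 := fun j => by
    have := abs_armMean_le (w := w) (a := a) (Nat.cast_nonneg M) fun i => hG.abs_feature_le w i j
    exact sq_le_sq' (abs_le.1 this).1 (abs_le.1 this).2
  have h0 := h 0
  have h1 := h 1
  simp only [armFit, Fin.sum_univ_two]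
  set s := armMean w a (fun i => feature G w i 0)
  set t := armMean w a (fun i => feature G w i 1)
  have e0 := mul_le_mul_of_nonneg_left h0 (sq_nonneg (Δ 0))
  have e1 := mul_le_mul_of_nonneg_left h1 (sq_nonneg (Δ 1))
  nlinarith [sq_nonneg (Δ 0 * s - Δ 1 * t)]

/-- The slopes of the regression functions. -/
def slopes (ξ : Bool → ℝ) (a : Bool) : Fin 2 → ℝ := ![ξ a, 0]

theorem outcome_of_mem_arm (α ξ : Bool → ℝ) (e : Fin n → ℝ) {i : Fin n} (hi : w i = a) :
    outcome α ξ G e w i = α a + ξ a * fracTreated G w i + e i := by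
  cases a <;> simp [outcome, regFun, hi]

theorem armMean_outcome (α ξ : Bool → ℝ) (e : Fin n → ℝ) (hm : 0 < armCard w a) :
    armMean w a (outcome α ξ G e w) =
      α a + ξ a * armMean w a (fracTreated G w) + armMean w a e := by
  have hm' : (armCard w a : ℝ) ≠ 0 := by exact_mod_cast hm.ne'
  have h : ∑ i : {i // w i = a}, outcome α ξ G e w i =
      armCard w a * α a + ξ a * ∑ i : {i // w i = a}, fracTreated G w i
        + ∑ i : {i // w i = a}, e i := by
    rw [Finset.sum_congr rfl fun (i : {i // w i = a}) _ => outcome_of_mem_arm α ξ e i.2,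
      Finset.sum_add_distrib, Finset.sum_add_distrib, Finset.sum_const, Finset.card_univ,
      nsmul_eq_mul, Finset.mul_sum]
  rw [armMean, h, armMean, armMean]
  field_simp

theorem response_outcome (α ξ : Bool → ℝ) (e : Fin n → ℝ) (hm : 0 < armCard w a)
    (i : {i // w i = a}) :
    response w a (outcome α ξ G e w) i =
      (design G w a).mulVec (slopes ξ a) i + response w a e i := by
  rw [response, armMean_outcome α ξ e hm, outcome_of_mem_arm α ξ e i.2, design_mulVec, response]
  simp [slopes, armFit, feature]
  ring

/-- The intercept inherits the slope error only through `armFit`. -/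
theorem intercept_outcome (α ξ : Bool → ℝ) (e : Fin n → ℝ) (hm : 0 < armCard w a)
    (b : Fin 2 → ℝ) :
    intercept G w a (outcome α ξ G e w) b =
      α a - armFit G w a (b - slopes ξ a) + armMean w a e := by
  rw [intercept, armMean_outcome α ξ e hm]
  simp [slopes, armFit, feature]
  ring

/-- The weights of the noise terms in the mean over the arm `a`, up to normalization. -/
def armIndicator (a : Bool) (i : Fin n) (w : Fin n → Bool) : ℝ := if w i = a then 1 else 0

/-- The weights of the noise terms in the empirical covariance of the noise with the feature `j`
over the arm `a`, up to normalization. -/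
def armWeight (G : SimpleGraph (Fin n)) (a : Bool) (j : Fin 2) (i : Fin n) (w : Fin n → Bool) :
    ℝ :=
  if w i = a then feature G w i j - armMean w a (fun i' => feature G w i' j) else 0

theorem abs_armIndicator_le (a : Bool) (i : Fin n) (w : Fin n → Bool) :
    |armIndicator a i w| ≤ 1 := by
  unfold armIndicator; split_ifs <;> simp

theorem abs_armWeight_le (hG : IsCliqueUnion G 3 M) (a : Bool) (j : Fin 2) (i : Fin n)
    (w : Fin n → Bool) : |armWeight G a j i w| ≤ 2 * M := by
  have h1 := hG.abs_feature_le w i j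
  have h2 := abs_armMean_le (w := w) (a := a) (Nat.cast_nonneg M) fun i => hG.abs_feature_le w i j
  unfold armWeight
  split_ifs
  · exact (abs_sub _ _).trans (by linarith)
  · simp

theorem armMean_eq_sum_armIndicator (e : Fin n → ℝ) :
    armMean w a e = (∑ i, armIndicator a i w * e i) / armCard w a := by
  rw [armMean, sum_arm]
  simp [armIndicator]

/-- Columns of the design sum to zero, so centering the noise changes nothing. The result is a noise
sum whose weights depend on the assignment alone, as `IsNoise.measureReal_le` requires. -/
theorem sum_design_mul_response (e : Fin n → ℝ) (hm : 0 < armCard w a) (j : Fin 2) :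
    ∑ i, design G w a i j * response w a e i = ∑ i, armWeight G a j i w * e i := by
  have h0 : ∑ i, design G w a i j = 0 := sum_sub_armMean hm fun i => feature G w i j
  have h1 : ∑ i, design G w a i j * response w a e i = ∑ i, design G w a i j * e i := by
    simp only [response, mul_sub]
    rw [Finset.sum_sub_distrib, ← Finset.sum_mul, h0, zero_mul, sub_zero]
  rw [h1]
  refine (sum_arm (w := w) (a := a) fun i =>
    (feature G w i j - armMean w a (fun i' => feature G w i' j)) * e i).trans ?_
  refine Finset.sum_congr rfl fun i _ => ?_
  unfold armWeight
  split_ifs <;> simp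

end Arm

/-! ### Exposure counts and the design -/

section Exposure

variable {n : ℕ} {G : SimpleGraph (Fin n)} {M : ℕ} {w : Fin n → Bool} {c η : ℝ}

open Classical in
/-- In every degree class and every arm, the units with all neighbors in a given arm make up a
fraction at least `c` of the class, up to an error of `η n` units. -/
def HasRichExposure (G : SimpleGraph (Fin n)) (w : Fin n → Bool) (M : ℕ) (c η : ℝ) : Prop :=
  ∀ (a b : Bool) (s : Fin (M + 1)),
    c * (Finset.univ.filter fun i => nbrCount G i = s).card - η * n ≤
      (Finset.univ.filter fun i => nbrCount G i = s ∧ HasExposure G a b i w).card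

open Classical in
-- On a degree class f is constant, so the class counts can be used directly; each of the M + 1
-- classes loses at most X η n.
theorem HasRichExposure.le_sum (h : HasRichExposure G w M c η) (hG : IsCliqueUnion G 3 M)
    (hη : 0 ≤ η) (a b : Bool) {f : ℕ → ℝ} {X : ℝ} (hf : ∀ s ≤ M, 0 ≤ f s)
    (hfX : ∀ s ≤ M, f s ≤ X) :
    c * ∑ i, f (nbrCount G i) - (M + 1) * X * η * n ≤
      ∑ i, if HasExposure G a b i w then f (nbrCount G i) else 0 := by
  have hmaps : ∀ i ∈ (Finset.univ : Finset (Fin n)), nbrCount G i ∈ Finset.range (M + 1) :=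
    fun i _ => Finset.mem_range.2 (Nat.lt_succ_of_le (hG.nbrCount_le i))
  rw [← Finset.sum_fiberwise_of_maps_to hmaps, ← Finset.sum_fiberwise_of_maps_to hmaps,
    Finset.mul_sum]
  have hconst : (M + 1) * X * η * n = ∑ _s ∈ Finset.range (M + 1), X * η * n := by
    rw [Finset.sum_const, Finset.card_range]; push_cast [nsmul_eq_mul]; ring
  rw [hconst, ← Finset.sum_sub_distrib]
  refine Finset.sum_le_sum fun s hs => ?_
  have hs' : s ≤ M := Nat.le_of_lt_succ (Finset.mem_range.1 hs)
  have e1 : ∑ i ∈ Finset.univ.filter (fun i => nbrCount G i = s), f (nbrCount G i) =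
      f s * (Finset.univ.filter fun i => nbrCount G i = s).card := by
    rw [Finset.sum_congr rfl fun i hi => by rw [(Finset.mem_filter.1 hi).2], Finset.sum_const,
      nsmul_eq_mul, mul_comm]
  have e2 : ∑ i ∈ Finset.univ.filter (fun i => nbrCount G i = s),
      (if HasExposure G a b i w then f (nbrCount G i) else 0) =
      f s * (Finset.univ.filter fun i => nbrCount G i = s ∧ HasExposure G a b i w).card := by
    rw [← Finset.sum_filter, Finset.filter_filter,
      Finset.sum_congr rfl fun i hi => by rw [(Finset.mem_filter.1 hi).2.1], Finset.sum_const,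
      nsmul_eq_mul, mul_comm]
  rw [e1, e2]
  have h1 := mul_le_mul_of_nonneg_left (h a b ⟨s, Finset.mem_range.1 hs⟩) (hf s hs')
  have h2 : f s * (η * n) ≤ X * (η * n) :=
    mul_le_mul_of_nonneg_right (hfX s hs') (by positivity)
  simp only at h1
  linarith

open Classical in
-- The exposed units are part of the arm, the other squares are nonnegative, and an arm has at most
-- n units.
theorem sum_exposure_le_meanSq (a b : Bool) (Δ : Fin 2 → ℝ) :
    ∑ i, (if HasExposure G a b i w then
      (∑ j, Δ j * feature G w i j - armFit G w a Δ) ^ 2 else 0) ≤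
        n * meanSq (design G w a) Δ := by
  set g : Fin n → ℝ := fun i => (∑ j, Δ j * feature G w i j - armFit G w a Δ) ^ 2 with hg
  have h1 : ∑ i, (if HasExposure G a b i w then g i else 0) ≤ ∑ i : {i // w i = a}, g i := by
    rw [sum_arm]
    refine Finset.sum_le_sum fun i _ => ?_
    have : 0 ≤ g i := sq_nonneg _
    by_cases h : HasExposure G a b i w
    · rw [if_pos h, if_pos h.1]
    · rw [if_neg h]; split_ifs <;> simp [this]
  refine h1.trans ?_
  have h2 : ∑ i, ((design G w a).mulVec Δ i) ^ 2 = ∑ i : {i // w i = a}, g i :=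
    Finset.sum_congr rfl fun i _ => by rw [design_mulVec]
  rw [meanSq, h2]
  -- In an empty arm both sides are sums over an empty type, so the division by 0 is harmless.
  rcases Nat.eq_zero_or_pos (armCard w a) with h0 | hpos
  · have : IsEmpty {i // w i = a} := Fintype.card_eq_zero_iff.1 h0
    simp
  · have hpos' : (0 : ℝ) < armCard w a := by exact_mod_cast hpos
    have hle : (armCard w a : ℝ) ≤ n := by exact_mod_cast armCard_le w a
    have hs : 0 ≤ ∑ i : {i // w i = a}, g i := Finset.sum_nonneg fun i _ => sq_nonneg _
    rw [← mul_assoc, mul_one_div]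
    exact le_mul_of_one_le_left hs ((one_le_div hpos').2 hle)

/-- Units without treated neighbors have feature 0, so each of them contributes exactly `armFit`² to
the mean square. -/
theorem HasRichExposure.armFit_sq_le (h : HasRichExposure G w M c η) (hG : IsCliqueUnion G 3 M)
    (hn : 0 < n) (hη : 0 ≤ η) (hc : 0 < c) (hηc : (M + 1) * η ≤ c / 2) (a : Bool)
    (Δ : Fin 2 → ℝ) : armFit G w a Δ ^ 2 ≤ 2 / c * meanSq (design G w a) Δ := by
  classical
  have hn' : (0 : ℝ) < n := by exact_mod_cast hn
  have h1 := h.le_sum hG hη a false (f := fun _ => armFit G w a Δ ^ 2)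
    (X := armFit G w a Δ ^ 2) (fun _ _ => sq_nonneg _) fun _ _ => le_rfl
  have h2 := sum_exposure_le_meanSq (G := G) (w := w) a false Δ
  have h3 : ∀ i, (if HasExposure G a false i w then
      (∑ j, Δ j * feature G w i j - armFit G w a Δ) ^ 2 else 0) =
      if HasExposure G a false i w then armFit G w a Δ ^ 2 else 0 := fun i => by
    split_ifs with hi
    · rw [hG.feature_of_hasExposure hi]; simp
    · rfl
  rw [Finset.sum_congr rfl fun i _ => h3 i] at h2
  have h4 := h1.trans h2
  rw [Finset.sum_const, Finset.card_univ, Fintype.card_fin, nsmul_eq_mul] at h4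
  have h5 : (c - (M + 1) * η) * armFit G w a Δ ^ 2 ≤ meanSq (design G w a) Δ := by
    refine le_of_mul_le_mul_left ?_ hn'
    linarith
  have h6 : c / 2 * armFit G w a Δ ^ 2 ≤ (c - (M + 1) * η) * armFit G w a Δ ^ 2 := by
    gcongr; linarith
  rw [div_mul_eq_mul_div, le_div_iff₀ hc]
  linarith

/-- The increase, on average over all units, of the linear function with slopes `Δ` from the
control features to the treatment features. -/
def meanContrast (G : SimpleGraph (Fin n)) (Δ : Fin 2 → ℝ) : ℝ :=
  Δ 0 + Δ 1 * ((∑ i, (nbrCount G i : ℝ)) / n)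

theorem sizeVariance_eq (hG : IsCliqueUnion G 3 M) (hn : 0 < n) :
    sizeVariance G = (∑ i, ((nbrCount G i : ℝ) - (∑ j, (nbrCount G j : ℝ)) / n) ^ 2) / n := by
  have hn' : (n : ℝ) ≠ 0 := by exact_mod_cast hn.ne'
  have h : ∀ i, (cliqueSize G i : ℝ) = nbrCount G i + 1 := fun i => by
    rw [← hG.nbrCount_add_one i]; push_cast; ring
  unfold sizeVariance
  simp_rw [h]
  congr 1
  refine Finset.sum_congr rfl fun i _ => ?_
  rw [Finset.sum_add_distrib]
  simp only [Finset.sum_const, Finset.card_univ, Fintype.card_fin, nsmul_eq_mul, mul_one]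
  rw [add_div, div_self hn']
  ring

/-- Bias-variance decomposition: the mean of Δ₀ + Δ₁ d over the units is `meanContrast`, and degrees
and clique sizes have the same variance. -/
theorem sum_contrast_sq (hG : IsCliqueUnion G 3 M) (hn : 0 < n) (Δ : Fin 2 → ℝ) (θ : ℝ) :
    ∑ i, (Δ 0 + Δ 1 * (nbrCount G i : ℝ) - θ) ^ 2 =
      n * ((meanContrast G Δ - θ) ^ 2 + Δ 1 ^ 2 * sizeVariance G) := by
  have hn' : (n : ℝ) ≠ 0 := by exact_mod_cast hn.ne'
  rw [sizeVariance_eq hG hn]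
  set m := (∑ i, (nbrCount G i : ℝ)) / n with hm
  have h0 : ∑ i, ((nbrCount G i : ℝ) - m) = 0 := by
    rw [Finset.sum_sub_distrib, hm]
    simp only [Finset.sum_const, Finset.card_univ, Fintype.card_fin, nsmul_eq_mul]
    field_simp
    simp
  have h1 : ∀ i, (Δ 0 + Δ 1 * (nbrCount G i : ℝ) - θ) ^ 2 =
      (meanContrast G Δ - θ) ^ 2 + 2 * (meanContrast G Δ - θ) * Δ 1 * ((nbrCount G i : ℝ) - m)
        + Δ 1 ^ 2 * ((nbrCount G i : ℝ) - m) ^ 2 := fun i => by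
    rw [meanContrast, ← hm]; ring
  rw [Finset.sum_congr rfl fun i _ => h1 i, Finset.sum_add_distrib, Finset.sum_add_distrib,
    ← Finset.mul_sum, ← Finset.mul_sum, h0, Finset.sum_const, Finset.card_univ, Fintype.card_fin,
    nsmul_eq_mul]
  field_simp
  ring

/-- Units with all neighbors treated have feature (1, d) and represent every degree class, so a sum
over them bounds a multiple of the sum over all units. -/
theorem HasRichExposure.contrast_le (h : HasRichExposure G w M c η) (hG : IsCliqueUnion G 3 M)
    (hM : 1 ≤ M) (hn : 0 < n) (hη : 0 ≤ η) (a : Bool) (Δ : Fin 2 → ℝ) :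
    c * ((meanContrast G Δ - armFit G w a Δ) ^ 2 + Δ 1 ^ 2 * sizeVariance G) ≤
      meanSq (design G w a) Δ + 9 * M ^ 2 * (M + 1) * η * ∑ j, Δ j ^ 2 := by
  classical
  have hn' : (0 : ℝ) < n := by exact_mod_cast hn
  have hM' : (1 : ℝ) ≤ M := by exact_mod_cast hM
  set θ := armFit G w a Δ with hθ
  -- The 9 is 3(1 + 2): the first two squares add up to at most M²|Δ|², and θ² is at most 2M²|Δ|².
  have hX : ∀ s ≤ M, (Δ 0 + Δ 1 * (s : ℝ) - θ) ^ 2 ≤ 9 * M ^ 2 * ∑ j, Δ j ^ 2 := fun s hs => by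
    have h1 := NetExp.armFit_sq_le hG w a Δ
    rw [Fin.sum_univ_two] at h1 ⊢
    have hs0 : (0 : ℝ) ≤ s := Nat.cast_nonneg _
    have hs1 : (s : ℝ) ≤ M := by exact_mod_cast hs
    have h2 : Δ 1 ^ 2 * (s : ℝ) ^ 2 ≤ Δ 1 ^ 2 * (M : ℝ) ^ 2 := by gcongr
    have h3 : Δ 0 ^ 2 * 1 ≤ Δ 0 ^ 2 * (M : ℝ) ^ 2 := by gcongr; exact one_le_pow₀ hM'
    have h4 : (Δ 0 + Δ 1 * (s : ℝ) - θ) ^ 2 ≤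
        3 * (Δ 0 ^ 2 + Δ 1 ^ 2 * (s : ℝ) ^ 2 + θ ^ 2) := by
      nlinarith [sq_nonneg (Δ 0 - Δ 1 * s), sq_nonneg (Δ 0 + θ), sq_nonneg (Δ 1 * s + θ)]
    linarith
  have h1 := h.le_sum hG hη a true (f := fun s => (Δ 0 + Δ 1 * (s : ℝ) - θ) ^ 2)
    (fun _ _ => sq_nonneg _) hX
  have h2 := sum_exposure_le_meanSq (G := G) (w := w) a true Δ
  have h3 : ∀ i, (if HasExposure G a true i w then
      (∑ j, Δ j * feature G w i j - armFit G w a Δ) ^ 2 else 0) =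
      if HasExposure G a true i w then (Δ 0 + Δ 1 * (nbrCount G i : ℝ) - θ) ^ 2 else 0 :=
    fun i => by
      split_ifs with hi
      · rw [hG.feature_of_hasExposure hi]; simp [hθ]
      · rfl
  rw [Finset.sum_congr rfl fun i _ => h3 i] at h2
  have h4 := h1.trans h2
  rw [sum_contrast_sq hG hn] at h4
  refine le_of_mul_le_mul_left ?_ hn'
  linarith

/-- If the clique sizes vary, then the design has no direction of small variance. -/
theorem HasRichExposure.le_meanSq (h : HasRichExposure G w M c η) (hG : IsCliqueUnion G 3 M)
    (hM : 1 ≤ M) (hn : 0 < n) (hη : 0 ≤ η) (hc : 0 < c) (hηc : (M + 1) * η ≤ c / 2)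
    {δ : ℝ} (hδ : 0 < δ) (hvar : δ ≤ sizeVariance G)
    (hηδ : (9 + (3 * M ^ 2 + 1) / δ) * (9 * M ^ 2 * (M + 1) * η) ≤ c / 2)
    (a : Bool) (Δ : Fin 2 → ℝ) :
    c / (2 * (9 + (3 * M ^ 2 + 1) / δ)) * ∑ j, Δ j ^ 2 ≤ meanSq (design G w a) Δ := by
  have hn' : (0 : ℝ) < n := by exact_mod_cast hn
  have h1 := h.contrast_le hG hM hn hη a Δ
  have h2 := h.armFit_sq_le hG hn hη hc hηc a Δ
  have hV := meanSq_nonneg (design G w a) Δ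
  have hd0 : 0 ≤ (∑ i, (nbrCount G i : ℝ)) / n := by positivity
  have hd1 : (∑ i, (nbrCount G i : ℝ)) / n ≤ M := by
    rw [div_le_iff₀ hn']
    calc ∑ i, (nbrCount G i : ℝ) ≤ ∑ _i : Fin n, (M : ℝ) :=
          Finset.sum_le_sum fun i _ => by exact_mod_cast hG.nbrCount_le i
      _ = M * n := by simp [mul_comm]
  set V := meanSq (design G w a) Δ
  set θ := armFit G w a Δ
  set D := meanContrast G Δ with hD
  set m := (∑ i, (nbrCount G i : ℝ)) / n
  set Q := ∑ j, Δ j ^ 2 with hQ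
  rw [Fin.sum_univ_two] at hQ
  have hQ0 : 0 ≤ Q := by rw [hQ]; positivity
  set L := 9 * (M : ℝ) ^ 2 * (M + 1) * η with hL
  have hL0 : 0 ≤ L := by positivity
  set u := (3 * (M : ℝ) ^ 2 + 1) / δ with hu
  have hu0 : 0 < u := by positivity
  have hDm : Δ 0 = (D - θ) + θ - Δ 1 * m := by rw [hD, meanContrast]; ring
  have hm2 : (Δ 1 * m) ^ 2 ≤ Δ 1 ^ 2 * M ^ 2 := by rw [mul_pow]; gcongr
  -- Δ₀ is recovered from the contrast, the arm fit and Δ₁, so bounds for these three bound |Δ|².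
  have h3 : Q ≤ 3 * (D - θ) ^ 2 + 3 * θ ^ 2 + (3 * M ^ 2 + 1) * Δ 1 ^ 2 := by
    have h4 : Δ 0 ^ 2 ≤ 3 * ((D - θ) ^ 2 + θ ^ 2 + (Δ 1 * m) ^ 2) := by
      rw [hDm]
      nlinarith [sq_nonneg ((D - θ) - θ), sq_nonneg ((D - θ) + Δ 1 * m), sq_nonneg (θ + Δ 1 * m)]
    rw [hQ]; linarith
  have h5 : c * ((D - θ) ^ 2 + Δ 1 ^ 2 * δ) ≤ V + L * Q := by
    refine le_trans ?_ h1
    gcongr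
  have h6 : c * (D - θ) ^ 2 ≤ V + L * Q := by
    refine le_trans ?_ h5
    have : 0 ≤ c * (Δ 1 ^ 2 * δ) := by positivity
    linarith
  have h7 : c * ((3 * M ^ 2 + 1) * Δ 1 ^ 2) ≤ u * (V + L * Q) := by
    have : c * (Δ 1 ^ 2 * δ) ≤ V + L * Q := by
      refine le_trans ?_ h5
      have : 0 ≤ c * (D - θ) ^ 2 := by positivity
      linarith
    calc c * ((3 * M ^ 2 + 1) * Δ 1 ^ 2) = u * (c * (Δ 1 ^ 2 * δ)) := by
          rw [hu]; field_simp
      _ ≤ _ := by gcongr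
  have h8 : c * θ ^ 2 ≤ 2 * V := by
    rw [div_mul_eq_mul_div, le_div_iff₀ hc] at h2
    linarith
  -- The three terms of `h3` cost 3(V + LQ), 6V and u(V + LQ). The smallness of η then lets half of
  -- cQ absorb the LQ part.
  have h9 : c * Q ≤ (9 + u) * (V + L * Q) := by
    have h10 := mul_le_mul_of_nonneg_left h3 hc.le
    have : 0 ≤ L * Q := by positivity
    linarith
  have h11 : (9 + u) * L * Q ≤ c / 2 * Q := by gcongr
  have h12 : c * Q ≤ 2 * (9 + u) * V := by linarith
  rw [div_mul_eq_mul_div, div_le_iff₀ (by positivity)]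
  linarith

theorem HasRichExposure.le_armCard (h : HasRichExposure G w M c η) (hG : IsCliqueUnion G 3 M)
    (hη : 0 ≤ η) (hηc : (M + 1) * η ≤ c / 2) (a : Bool) :
    c / 2 * n ≤ armCard w a := by
  classical
  have h1 := h.le_sum hG hη a true (f := fun _ => 1) (X := 1) (fun _ _ => zero_le_one)
    fun _ _ => le_rfl
  have h2 : ∑ i, (if HasExposure G a true i w then (1 : ℝ) else 0) ≤ armCard w a := by
    have : (armCard w a : ℝ) = ∑ i : {i // w i = a}, 1 := by simp
    rw [this, sum_arm (fun _ => (1 : ℝ))]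
    refine Finset.sum_le_sum fun i _ => ?_
    by_cases hi : HasExposure G a true i w
    · rw [if_pos hi, if_pos hi.1]
    · rw [if_neg hi]; split_ifs <;> simp
  have h3 := h1.trans h2
  simp only [Finset.sum_const, Finset.card_univ, Fintype.card_fin, nsmul_eq_mul, mul_one] at h3
  have h4 : (M + 1) * η * n ≤ c / 2 * n := by gcongr
  linarith

end Exposure

/-! ### The estimates -/

section Estimate

variable {n : ℕ} {G : SimpleGraph (Fin n)} {M : ℕ}

/-- All features vanish under global control, so the control slopes matter only through their
intercept. -/
theorem gateEstimate_eq (hG : IsCliqueUnion G 3 M) (hn : 0 < n) (c : Bool → ℝ)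
    (b : Bool → Fin 2 → ℝ) :
    gateEstimate G c b = c true + meanContrast G (b true) - c false := by
  have hn' : (n : ℝ) ≠ 0 := by exact_mod_cast hn.ne'
  unfold gateEstimate meanContrast
  simp_rw [hG.feature_const]
  simp only [Fin.sum_univ_two, if_true, Matrix.cons_val_zero, Matrix.cons_val_one, mul_one,
    Pi.zero_apply, mul_zero, add_zero, Finset.sum_sub_distrib, Finset.sum_add_distrib,
    Finset.sum_const, Finset.card_univ, Fintype.card_fin, nsmul_eq_mul, ← Finset.mul_sum,
    Bool.false_eq_true, if_false]
  field_simp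

theorem meanContrast_sub_slopes (ξ : Bool → ℝ) (a : Bool) (b : Fin 2 → ℝ) :
    meanContrast G (b - slopes ξ a) = meanContrast G b - ξ a := by
  simp [meanContrast, slopes]; ring

/-- The same noise occurs in both potential outcomes and cancels before integration. -/
theorem Experiment.gate_eq {p : ℝ} (E : Experiment.{u} p M) (hn : 0 < E.n) (α ξ : Bool → ℝ)
    (ε : Fin E.n → E.Ω → ℝ) : E.gate α ξ ε = α true + ξ true - α false := by
  have hn' : (E.n : ℝ) ≠ 0 := by exact_mod_cast hn.ne'
  have hρ : ∀ b i, fracTreated E.G (fun _ => b) i = if b = true then 1 else 0 := fun b i => by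
    have := congrFun (E.cliques.feature_const b i) 0
    cases b <;> simpa [feature] using this
  unfold gate
  simp only [outcome, regFun, hρ]
  simp
  field_simp

end Estimate


/-! ### Calculus of events with probability tending to one. -/

section HighProb

variable {p : ℝ} {M : ℕ} {E : ℕ → Experiment.{u} p M}

/-- Along the sequence `E` of experiments, the events `S k` have probability tending to `1`
(in terms of the outer measure of the complement). -/
def HighProb (E : ℕ → Experiment.{u} p M) (S : ∀ k, (E k).Ω → Prop) : Prop :=
  Tendsto (fun k => (E k).P {ω | ¬ S k ω}) atTop (𝓝 0)

theorem HighProb.mono {S T : ∀ k, (E k).Ω → Prop} (h : HighProb E S)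
    (hST : ∀ᶠ k in atTop, ∀ᵐ ω ∂(E k).P, S k ω → T k ω) : HighProb E T := by
  refine tendsto_of_tendsto_of_tendsto_of_le_of_le' tendsto_const_nhds h
    (Eventually.of_forall fun _ => zero_le) ?_
  filter_upwards [hST] with k hk
  refine measure_mono_ae ?_
  filter_upwards [hk] with ω hω hT hS
  exact hT (hω hS)

theorem HighProb.mono' {S T : ∀ k, (E k).Ω → Prop} (h : HighProb E S)
    (hST : ∀ᶠ k in atTop, ∀ ω, S k ω → T k ω) : HighProb E T :=
  h.mono (hST.mono fun _ hk => ae_of_all _ hk)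

theorem HighProb.and {S T : ∀ k, (E k).Ω → Prop} (hS : HighProb E S) (hT : HighProb E T) :
    HighProb E fun k ω => S k ω ∧ T k ω := by
  have h := Tendsto.add hS hT
  rw [add_zero] at h
  refine tendsto_of_tendsto_of_tendsto_of_le_of_le tendsto_const_nhds h
    (fun _ => zero_le) fun k => ?_
  refine (measure_mono ?_).trans (measure_union_le _ _)
  intro ω hω
  exact not_and_or.1 hω

theorem HighProb.all {ι : Type*} [Fintype ι] {S : ι → ∀ k, (E k).Ω → Prop}
    (h : ∀ i, HighProb E (S i)) : HighProb E fun k ω => ∀ i, S i k ω := by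
  have h' := tendsto_finsetSum Finset.univ fun i _ => h i
  rw [Finset.sum_const_zero] at h'
  refine tendsto_of_tendsto_of_tendsto_of_le_of_le tendsto_const_nhds h'
    (fun _ => zero_le) fun k => ?_
  refine (measure_mono ?_).trans (measure_iUnion_fintype_le _ fun i => {ω | ¬ S i k ω})
  intro ω hω
  exact Set.mem_iUnion.2 (not_forall.1 hω)

theorem highProb_of_eventually {S : ∀ k, (E k).Ω → Prop}
    (h : ∀ᶠ k in atTop, ∀ᵐ ω ∂(E k).P, S k ω) : HighProb E S := by
  refine Tendsto.congr' (f₁ := fun _ => 0) ?_ tendsto_const_nhds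
  filter_upwards [h] with k hk
  exact (ae_iff.1 hk).symm

theorem highProb_of_measureReal_le {S : ∀ k, (E k).Ω → Prop} {x : ℕ → ℝ}
    (hx : Tendsto x atTop (𝓝 0)) (h : ∀ᶠ k in atTop, (E k).P.real {ω | ¬ S k ω} ≤ x k) :
    HighProb E S := by
  have hx' := ENNReal.tendsto_ofReal hx
  rw [ENNReal.ofReal_zero] at hx'
  refine tendsto_of_tendsto_of_tendsto_of_le_of_le' tendsto_const_nhds hx'
    (Eventually.of_forall fun _ => zero_le) ?_
  filter_upwards [h] with k hk
  rw [← ofReal_measureReal]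
  exact ENNReal.ofReal_le_ofReal hk

/-- Subadditivity alone gives 1 ≤ P(S) + P(not S), so no measurability of S is needed. -/
theorem HighProb.tendsto_one {S : ∀ k, (E k).Ω → Prop} (h : HighProb E S) :
    Tendsto (fun k => (E k).P {ω | S k ω}) atTop (𝓝 1) := by
  have h1 : Tendsto (fun k => 1 - (E k).P {ω | ¬ S k ω}) atTop (𝓝 (1 - 0)) :=
    ENNReal.Tendsto.sub tendsto_const_nhds h (Or.inl ENNReal.one_ne_top)
  rw [tsub_zero] at h1
  refine tendsto_of_tendsto_of_tendsto_of_le_of_le h1 tendsto_const_nhds (fun k => ?_)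
    fun k => prob_le_one
  rw [tsub_le_iff_right, ← measure_univ (μ := (E k).P)]
  refine (measure_mono ?_).trans (measure_union_le _ _)
  intro ω _
  exact em (S k ω)

theorem isConsistent_of_highProb {T : ∀ k, (E k).Ω → ℝ} {τ : ℕ → ℝ}
    (h : ∀ η : ℝ, 0 < η → HighProb E fun k ω => |T k ω - τ k| < η) : IsConsistent E T τ := by
  intro η hη
  simpa [HighProb] using h η hη


end HighProb


/-! ### Noise bounds and consistency along the sequence of experiments. -/

section Asymptotics

variable {p : ℝ} {M : ℕ} {E : ℕ → Experiment.{u} p M}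

theorem exists_pos_mul_le {A B x y : ℝ} (hA : 0 ≤ A) (hB : 0 ≤ B) (hx : 0 < x) (hy : 0 < y) :
    ∃ η : ℝ, 0 < η ∧ A * η ≤ x ∧ B * η ≤ y := by
  refine ⟨min (x / (A + 1)) (y / (B + 1)), lt_min (by positivity) (by positivity), ?_, ?_⟩
  · calc A * min (x / (A + 1)) (y / (B + 1)) ≤ (A + 1) * (x / (A + 1)) := by
          gcongr
          · linarith
          · exact min_le_left _ _
      _ = x := by field_simp
  · calc B * min (x / (A + 1)) (y / (B + 1)) ≤ (B + 1) * (y / (B + 1)) := by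
          gcongr
          · linarith
          · exact min_le_right _ _
      _ = y := by field_simp

/-- A lower bound for the probability of an exposure pattern in a clique. -/
def minExposure (p : ℝ) (M : ℕ) : ℝ := min p (1 - p) ^ M

theorem minExposure_pos (hp0 : 0 < p) (hp1 : p < 1) : 0 < minExposure p M :=
  pow_pos (lt_min hp0 (by linarith)) _

theorem tendsto_natCast_n (hn : Tendsto (fun k => (E k).n) atTop atTop) :
    Tendsto (fun k => ((E k).n : ℝ)) atTop atTop :=
  tendsto_natCast_atTop_atTop.comp hn

theorem highProb_hasRichExposure (hp0 : 0 < p) (hp1 : p < 1)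
    (hn : Tendsto (fun k => (E k).n) atTop atTop) {η : ℝ} (hη : 0 < η) :
    HighProb E fun k ω =>
      HasRichExposure (E k).G ((E k).assignment ω) M (minExposure p M) η := by
  unfold HasRichExposure
  refine HighProb.all fun a => HighProb.all fun b => HighProb.all fun s => ?_
  refine highProb_of_measureReal_le (x := fun k => M / (η ^ 2 * (E k).n)) ?_ ?_
  · exact tendsto_const_nhds.div_atTop ((tendsto_natCast_n hn).const_mul_atTop (by positivity))
  · filter_upwards [hn.eventually_gt_atTop 0] with k hk
    exact (E k).measureReal_exposure_count_le hp0 hp1 a b s hη hk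

theorem highProb_le_armCard (hp0 : 0 < p) (hp1 : p < 1)
    (hn : Tendsto (fun k => (E k).n) atTop atTop) :
    HighProb E fun k ω => ∀ a,
      minExposure p M / 2 * (E k).n ≤ armCard ((E k).assignment ω) a := by
  have hc := minExposure_pos (M := M) hp0 hp1
  obtain ⟨η, hη, h1, -⟩ := exists_pos_mul_le (A := M + 1) (B := 0) (by positivity) le_rfl
    (half_pos hc) one_pos
  refine (highProb_hasRichExposure hp0 hp1 hn hη).mono' (Eventually.of_forall fun k ω h a => ?_)
  exact h.le_armCard (E k).cliques hη.le h1 a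

theorem highProb_armCard_pos (hp0 : 0 < p) (hp1 : p < 1)
    (hn : Tendsto (fun k => (E k).n) atTop atTop) :
    HighProb E fun k ω => ∀ a, 0 < armCard ((E k).assignment ω) a := by
  have hc := minExposure_pos (M := M) hp0 hp1
  refine (highProb_le_armCard hp0 hp1 hn).mono' ?_
  filter_upwards [hn.eventually_gt_atTop 0] with k hk ω h a
  have hk' : (0 : ℝ) < (E k).n := by exact_mod_cast hk
  have : (0 : ℝ) < armCard ((E k).assignment ω) a := lt_of_lt_of_le (by positivity) (h a)
  exact_mod_cast this

/-- All eigenvalues of the covariance matrices of the features within the two arms are bounded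
below, with high probability. -/
theorem exists_highProb_le_meanSq (hp0 : 0 < p) (hp1 : p < 1) (hM : 1 ≤ M) {δ : ℝ} (hδ : 0 < δ) :
    ∃ κ : ℝ, 0 < κ ∧ ∀ E : ℕ → Experiment.{u} p M, Tendsto (fun k => (E k).n) atTop atTop →
      (∀ᶠ k in atTop, δ ≤ sizeVariance (E k).G) →
      HighProb E fun k ω => ∀ (a : Bool) (Δ : Fin 2 → ℝ),
        κ * ∑ j, Δ j ^ 2 ≤ meanSq (design (E k).G ((E k).assignment ω) a) Δ := by
  have hc := minExposure_pos (M := M) hp0 hp1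
  refine ⟨minExposure p M / (2 * (9 + (3 * M ^ 2 + 1) / δ)), by positivity,
    fun E hn hvar => ?_⟩
  obtain ⟨η, hη, h1, h2⟩ := exists_pos_mul_le (A := M + 1)
    (B := (9 + (3 * M ^ 2 + 1) / δ) * (9 * M ^ 2 * (M + 1))) (by positivity) (by positivity)
    (half_pos hc) (half_pos hc)
  refine (highProb_hasRichExposure hp0 hp1 hn hη).mono' ?_
  filter_upwards [hn.eventually_gt_atTop 0, hvar] with k hk hv ω h a Δ
  exact h.le_meanSq (E k).cliques hM hk hη.le hc h1 hδ hv (by linarith) a Δ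

variable {σ : ℝ} {ε : ∀ k, Fin (E k).n → (E k).Ω → ℝ}

/-- The noise sum is of order √n in probability, so it lies below any random threshold that
eventually exceeds each multiple of √n. -/
theorem highProb_abs_noise_le (hn : Tendsto (fun k => (E k).n) atTop atTop)
    (hε : ∀ k, (E k).IsNoise σ (ε k)) (c : ∀ k, Fin (E k).n → (Fin (E k).n → Bool) → ℝ) {B : ℝ}
    (hB : 0 ≤ B) (hc : ∀ k i w, |c k i w| ≤ B) (T : ∀ k, (E k).Ω → ℝ)
    (hT : ∀ K : ℝ, 0 < K → HighProb E fun k ω => K * √((E k).n : ℝ) ≤ T k ω) :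
    HighProb E fun k ω => |∑ i, c k i ((E k).assignment ω) * ε k i ω| ≤ T k ω := by
  rw [HighProb, ENNReal.tendsto_nhds_zero]
  intro e he
  obtain ⟨e', he', hee⟩ : ∃ e' : ℝ, 0 < e' ∧ ENNReal.ofReal e' + ENNReal.ofReal e' ≤ e := by
    rcases eq_or_ne e ⊤ with rfl | htop
    · exact ⟨1, one_pos, le_top⟩
    · refine ⟨e.toReal / 2, half_pos (ENNReal.toReal_pos he.ne' htop), ?_⟩
      rw [← ENNReal.ofReal_add (by positivity) (by positivity), add_halves,
        ENNReal.ofReal_toReal htop]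
  -- Chebyshev at K√n gives B²σ²/K² ≤ e'; the added 1 keeps K positive when Bσ = 0.
  set K := √((B ^ 2 * σ ^ 2 + 1) / e') with hK
  have hK0 : 0 < K := Real.sqrt_pos.2 (by positivity)
  have hK2 : K ^ 2 = (B ^ 2 * σ ^ 2 + 1) / e' := Real.sq_sqrt (by positivity)
  have h1 := (ENNReal.tendsto_nhds_zero.1 (hT K hK0)) (ENNReal.ofReal e')
    (ENNReal.ofReal_pos.2 he')
  filter_upwards [h1, hn.eventually_gt_atTop 0] with k hk hnk
  have hnk' : (0 : ℝ) < (E k).n := by exact_mod_cast hnk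
  have h2 := (hε k).measureReal_le (E k) (c k) hB (hc k)
    (t := K * √((E k).n : ℝ)) (by positivity)
  have h3 : B ^ 2 * σ ^ 2 * (E k).n / (K * √((E k).n : ℝ)) ^ 2 ≤ e' := by
    rw [mul_pow, Real.sq_sqrt hnk'.le, hK2, div_le_iff₀ (by positivity)]
    field_simp
    linarith
  have h4 : (E k).P {ω | K * √((E k).n : ℝ) ≤ |∑ i, c k i ((E k).assignment ω) * ε k i ω|} ≤
      ENNReal.ofReal e' := by
    rw [← ofReal_measureReal]
    exact ENNReal.ofReal_le_ofReal (h2.trans h3)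
  refine le_trans ?_ ((add_le_add hk h4).trans hee)
  refine (measure_mono ?_).trans (measure_union_le _ _)
  intro ω hω
  by_cases h : K * √((E k).n : ℝ) ≤ T k ω
  · right
    exact h.trans (not_le.1 hω).le
  · left
    exact h

theorem highProb_abs_noise_le_mul (hn : Tendsto (fun k => (E k).n) atTop atTop)
    (hε : ∀ k, (E k).IsNoise σ (ε k)) (c : ∀ k, Fin (E k).n → (Fin (E k).n → Bool) → ℝ) {B : ℝ}
    (hB : 0 ≤ B) (hc : ∀ k i w, |c k i w| ≤ B) {η : ℝ} (hη : 0 < η) :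
    HighProb E fun k ω => |∑ i, c k i ((E k).assignment ω) * ε k i ω| ≤ η * (E k).n := by
  refine highProb_abs_noise_le hn hε c hB hc _ fun K hK => highProb_of_eventually ?_
  have h := (Real.tendsto_sqrt_atTop.comp (tendsto_natCast_n hn)).eventually_ge_atTop (K / η)
  filter_upwards [h] with k hk
  refine ae_of_all _ fun ω => ?_
  rw [Function.comp_apply, div_le_iff₀ hη] at hk
  calc K * √((E k).n : ℝ) ≤ √((E k).n : ℝ) * η * √((E k).n : ℝ) := by gcongr
    _ = η * (√((E k).n : ℝ) * √((E k).n : ℝ)) := by ring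
    _ = η * (E k).n := by rw [Real.mul_self_sqrt (Nat.cast_nonneg _)]

theorem highProb_abs_noise_le_mul_armCard (hp0 : 0 < p) (hp1 : p < 1)
    (hn : Tendsto (fun k => (E k).n) atTop atTop)
    (hε : ∀ k, (E k).IsNoise σ (ε k)) (c : ∀ k, Fin (E k).n → (Fin (E k).n → Bool) → ℝ) {B : ℝ}
    (hB : 0 ≤ B) (hc : ∀ k i w, |c k i w| ≤ B) (a : Bool) {η : ℝ} (hη : 0 < η) :
    HighProb E fun k ω => |∑ i, c k i ((E k).assignment ω) * ε k i ω| ≤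
      η * armCard ((E k).assignment ω) a := by
  have hc0 := minExposure_pos (M := M) hp0 hp1
  refine ((highProb_abs_noise_le_mul hn hε c hB hc
    (mul_pos hη (half_pos hc0))).and (highProb_le_armCard hp0 hp1 hn)).mono'
    (Eventually.of_forall fun k ω h => h.1.trans ?_)
  rw [mul_assoc]
  exact mul_le_mul_of_nonneg_left (h.2 a) hη.le

/-- With m at least a fixed fraction of n, mλ(m) = √m · (√m λ(m)) exceeds every multiple of √n. The
penalty is evaluated at the random arm size, so a bound for all m ≥ m₀ is used. -/
theorem highProb_abs_noise_le_penalty (hp0 : 0 < p) (hp1 : p < 1)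
    (hn : Tendsto (fun k => (E k).n) atTop atTop)
    (hε : ∀ k, (E k).IsNoise σ (ε k)) (c : ∀ k, Fin (E k).n → (Fin (E k).n → Bool) → ℝ) {B : ℝ}
    (hB : 0 ≤ B) (hc : ∀ k i w, |c k i w| ≤ B) (a : Bool) {lam : ℕ → ℝ}
    (hlam : Tendsto (fun m : ℕ => √(m : ℝ) * lam m) atTop atTop) :
    HighProb E fun k ω => |∑ i, c k i ((E k).assignment ω) * ε k i ω| ≤
      armCard ((E k).assignment ω) a * lam (armCard ((E k).assignment ω) a) / 2 := by
  have hc0 := half_pos (minExposure_pos (M := M) hp0 hp1)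
  refine highProb_abs_noise_le hn hε c hB hc _ fun K hK =>
    (highProb_le_armCard hp0 hp1 hn).mono' ?_
  set c' := minExposure p M / 2 with hc'
  obtain ⟨m₀, hm₀⟩ := eventually_atTop.1 (hlam.eventually_ge_atTop (2 * K / √c'))
  filter_upwards [((tendsto_natCast_n hn).const_mul_atTop hc0).eventually_ge_atTop (m₀ : ℝ)]
    with k hk ω h
  set m := armCard ((E k).assignment ω) a with hm
  have h1 : c' * (E k).n ≤ m := h a
  have h2 : m₀ ≤ m := by exact_mod_cast hk.trans h1
  have h3 := hm₀ m h2
  have hs : 0 < √c' := Real.sqrt_pos.2 hc0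
  have h4 : √c' * √((E k).n : ℝ) ≤ √(m : ℝ) := by
    rw [← Real.sqrt_mul hc0.le]; exact Real.sqrt_le_sqrt h1
  have h5 : √c' * √((E k).n : ℝ) * (2 * K / √c') ≤ √(m : ℝ) * (√(m : ℝ) * lam m) := by gcongr
  have h6 : √c' * √((E k).n : ℝ) * (2 * K / √c') = 2 * (K * √((E k).n : ℝ)) := by
    field_simp
  rw [h6, ← mul_assoc √(m : ℝ), Real.mul_self_sqrt (Nat.cast_nonneg _)] at h5
  linarith

/-- The slopes `b` have a small in-sample prediction error and a bounded estimation error. -/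
def IsPredictive (E : ℕ → Experiment.{u} p M) (ξ : Bool → ℝ)
    (b : ∀ k, (E k).Ω → Bool → Fin 2 → ℝ) : Prop :=
  ∃ B : ℝ, 0 < B ∧ ∀ v : ℝ, 0 < v → HighProb E fun k ω => ∀ a,
    meanSq (design (E k).G ((E k).assignment ω) a) (b k ω a - slopes ξ a) ≤ v ∧
      ∑ j, (b k ω a - slopes ξ a) j ^ 2 ≤ B

variable {α ξ : Bool → ℝ} {b : ∀ k, (E k).Ω → Bool → Fin 2 → ℝ}

/-- The bridge from prediction to causal error. Here the term η'|Δ|² of `contrast_le` is removed by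
boundedness of Δ instead of variation of the sizes: η' is chosen after B. -/
theorem IsPredictive.highProb (hp0 : 0 < p) (hp1 : p < 1) (hM : 1 ≤ M)
    (hn : Tendsto (fun k => (E k).n) atTop atTop) (hb : IsPredictive E ξ b) {η : ℝ}
    (hη : 0 < η) :
    HighProb E fun k ω => ∀ a,
      |armFit (E k).G ((E k).assignment ω) a (b k ω a - slopes ξ a)| ≤ η ∧
        |meanContrast (E k).G (b k ω a - slopes ξ a)| ≤ 2 * η := by
  obtain ⟨B, hB, hb⟩ := hb
  have hc := minExposure_pos (M := M) hp0 hp1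
  set c := minExposure p M
  obtain ⟨η', hη', h1, h2⟩ := exists_pos_mul_le (A := M + 1)
    (B := 9 * M ^ 2 * (M + 1) * B) (x := c / 2) (y := c * η ^ 2 / 2) (by positivity)
    (by positivity) (by positivity) (by positivity)
  refine ((hb (c * η ^ 2 / 2) (by positivity)).and
    (highProb_hasRichExposure hp0 hp1 hn hη')).mono' ?_
  filter_upwards [hn.eventually_gt_atTop 0] with k hk ω h a
  obtain ⟨h3, h4⟩ := h.1 a
  set Δ := b k ω a - slopes ξ a
  have h5 := h.2.armFit_sq_le (E k).cliques hk hη'.le hc h1 a Δ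
  have h6 := h.2.contrast_le (E k).cliques hM hk hη'.le a Δ
  set θ := armFit (E k).G ((E k).assignment ω) a Δ
  set D := meanContrast (E k).G Δ
  have h7 : θ ^ 2 ≤ η ^ 2 := by
    calc θ ^ 2 ≤ _ := h5
      _ ≤ 2 / c * (c * η ^ 2 / 2) := by gcongr
      _ = η ^ 2 := by field_simp
  have h8 : (D - θ) ^ 2 ≤ η ^ 2 := by
    have hv : 0 ≤ c * (Δ 1 ^ 2 * sizeVariance (E k).G) := by
      have : 0 ≤ sizeVariance (E k).G := by unfold sizeVariance; positivity
      positivity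
    have h9 : 9 * M ^ 2 * (M + 1) * η' * ∑ j, Δ j ^ 2 ≤ 9 * M ^ 2 * (M + 1) * η' * B := by gcongr
    refine le_of_mul_le_mul_left ?_ hc
    linarith
  have h10 := abs_le.1 (abs_le_of_sq_le_sq h7 hη.le)
  have h11 := abs_le.1 (abs_le_of_sq_le_sq h8 hη.le)
  refine ⟨abs_le.2 h10, abs_le.2 ⟨?_, ?_⟩⟩ <;> linarith [h10.1, h10.2, h11.1, h11.2]

theorem highProb_armMean_noise (hp0 : 0 < p) (hp1 : p < 1)
    (hn : Tendsto (fun k => (E k).n) atTop atTop) (hε : ∀ k, (E k).IsNoise σ (ε k)) {η : ℝ}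
    (hη : 0 < η) :
    HighProb E fun k ω => ∀ a, |armMean ((E k).assignment ω) a (fun i => ε k i ω)| ≤ η := by
  refine HighProb.all fun a => ?_
  refine ((highProb_abs_noise_le_mul_armCard hp0 hp1 hn hε (fun k => armIndicator a) zero_le_one
    (fun _ => abs_armIndicator_le a) a hη).and (highProb_armCard_pos hp0 hp1 hn)).mono'
    (Eventually.of_forall fun k ω h => ?_)
  have hpos : (0 : ℝ) < armCard ((E k).assignment ω) a := by exact_mod_cast h.2 a
  rw [armMean_eq_sum_armIndicator, abs_div, Nat.abs_cast, div_le_iff₀ hpos]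
  exact h.1

theorem IsPredictive.isConsistent_tauHat (hp0 : 0 < p) (hp1 : p < 1) (hM : 1 ≤ M)
    (hn : Tendsto (fun k => (E k).n) atTop atTop) (hε : ∀ k, (E k).IsNoise σ (ε k))
    (hb : IsPredictive E ξ b) :
    IsConsistent E (fun k => (E k).tauHat α ξ (ε k) (b k)) (fun k => (E k).gate α ξ (ε k)) := by
  refine isConsistent_of_highProb fun η hη => ?_
  -- The error is at most 6η/7: 2 for the treated contrast, 1 for each of two arm fits and two noise
  -- means; the seventh part makes the inequality strict.
  have hη' : 0 < η / 7 := by positivity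
  refine (((hb.highProb hp0 hp1 hM hn hη').and (highProb_armMean_noise hp0 hp1 hn hε hη')).and
    (highProb_armCard_pos hp0 hp1 hn)).mono' ?_
  filter_upwards [hn.eventually_gt_atTop 0] with k hk ω h
  obtain ⟨⟨h1, h2⟩, h3⟩ := h
  rw [Experiment.tauHat, gateEstimate_eq (E k).cliques hk, (E k).gate_eq hk,
    Experiment.observed, intercept_outcome _ _ _ (h3 true), intercept_outcome _ _ _ (h3 false)]
  have h4 := h1 true
  have h5 := h1 false
  rw [meanContrast_sub_slopes] at h4 h5
  have t1 := abs_le.1 h4.1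
  have t2 := abs_le.1 h4.2
  have t3 := abs_le.1 h5.1
  have t4 := abs_le.1 (h2 true)
  have t5 := abs_le.1 (h2 false)
  rw [abs_lt]
  constructor <;> linarith [t1.1, t1.2, t2.1, t2.2, t3.1, t3.2, t4.1, t4.2, t5.1, t5.2]

theorem IsPredictive.isConsistent_tauHatSlopes (hp0 : 0 < p) (hp1 : p < 1) (hM : 1 ≤ M)
    (hn : Tendsto (fun k => (E k).n) atTop atTop) (hb : IsPredictive E ξ b)
    (hα : α true = α false) :
    IsConsistent E (fun k => (E k).tauHatSlopes (b k)) (fun k => (E k).gate α ξ (ε k)) := by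
  refine isConsistent_of_highProb fun η hη => ?_
  refine (hb.highProb hp0 hp1 hM hn (by positivity : 0 < η / 3)).mono' ?_
  filter_upwards [hn.eventually_gt_atTop 0] with k hk ω h
  rw [Experiment.tauHatSlopes, gateEstimate_eq (E k).cliques hk, (E k).gate_eq hk]
  have h1 := (h true).2
  rw [meanContrast_sub_slopes] at h1
  have t := abs_le.1 h1
  rw [abs_lt]
  constructor <;> linarith [t.1, t.2]

theorem sum_abs_slopes (ξ : Bool → ℝ) (a : Bool) : ∑ j, |slopes ξ a j| = |ξ a| := by
  simp [slopes]

theorem isPredictive_of_isLassoFit (hp0 : 0 < p) (hp1 : p < 1)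
    (hn : Tendsto (fun k => (E k).n) atTop atTop) (hε : ∀ k, (E k).IsNoise σ (ε k))
    {lam : Bool → ℕ → ℝ} (hpos : ∀ a m, 0 < lam a m) (hzero : ∀ a, Tendsto (lam a) atTop (𝓝 0))
    (hlam : ∀ a, Tendsto (fun m : ℕ => √(m : ℝ) * lam a m) atTop atTop)
    (hb : ∀ k, (E k).IsLassoFit α ξ (ε k) lam (b k)) : IsPredictive E ξ b := by
  have hc0 := half_pos (minExposure_pos (M := M) hp0 hp1)
  set R : ℝ := |ξ true| + |ξ false| with hR
  have hξ : ∀ a, |ξ a| ≤ R := fun a => by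
    have := abs_nonneg (ξ true)
    have := abs_nonneg (ξ false)
    cases a <;> simp only [hR] <;> linarith
  have hR0 : 0 ≤ R := (abs_nonneg _).trans (hξ true)
  -- The ℓ¹ error is at most ‖b‖₁ + ‖β‖₁ ≤ 3R + R, independently of v.
  refine ⟨(4 * R) ^ 2 + 1, by positivity, fun v hv => HighProb.all fun a => ?_⟩
  have hnoise : HighProb E fun k ω => ∀ j,
      |∑ i, armWeight (E k).G a j i ((E k).assignment ω) * ε k i ω| ≤
        armCard ((E k).assignment ω) a * lam a (armCard ((E k).assignment ω) a) / 2 :=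
    HighProb.all fun j => highProb_abs_noise_le_penalty hp0 hp1 hn hε
      (fun k => armWeight (E k).G a j) (by positivity : (0 : ℝ) ≤ 2 * M)
      (fun k => abs_armWeight_le (E k).cliques a j) a (hlam a)
  refine ((hnoise.and (highProb_armCard_pos hp0 hp1 hn)).and
    (highProb_le_armCard hp0 hp1 hn)).mono ?_
  have hv' : 0 < v / (3 * (R + 1)) := by positivity
  obtain ⟨m₀, hm₀⟩ := eventually_atTop.1 ((hzero a).eventually_le_const hv')
  filter_upwards [((tendsto_natCast_n hn).const_mul_atTop hc0).eventually_ge_atTop (m₀ : ℝ)]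
    with k hk
  filter_upwards [hb k] with ω hω h
  obtain ⟨⟨h1, h2⟩, h3⟩ := h
  have h4 : m₀ ≤ armCard ((E k).assignment ω) a := by exact_mod_cast hk.trans (h3 a)
  have h5 := hm₀ _ h4
  have h6 := (hω a).bounds (hpos a _) (h2 a)
    (fun i => response_outcome α ξ (fun i => ε k i ω) (h2 a) i)
    (fun j => by rw [sum_design_mul_response _ (h2 a)]; exact h1 j)
  rw [sum_abs_slopes] at h6
  refine ⟨h6.1.trans ?_, ?_⟩
  · calc 3 * lam a _ * |ξ a| ≤ 3 * (v / (3 * (R + 1))) * (R + 1) := by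
          gcongr
          linarith [hξ a]
      _ = v := by field_simp
  · have h7 : ∑ j, |(b k ω a - slopes ξ a) j| ≤ 4 * R := by
      calc ∑ j, |(b k ω a - slopes ξ a) j| ≤ ∑ j, (|b k ω a j| + |slopes ξ a j|) :=
            Finset.sum_le_sum fun j _ => abs_sub _ _
        _ = ∑ j, |b k ω a j| + |ξ a| := by rw [Finset.sum_add_distrib, sum_abs_slopes]
        _ ≤ 4 * R := by linarith [h6.2, hξ a]
    calc ∑ j, (b k ω a - slopes ξ a) j ^ 2 = ∑ j, |(b k ω a - slopes ξ a) j| ^ 2 := by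
          simp_rw [sq_abs]
      _ ≤ (∑ j, |(b k ω a - slopes ξ a) j|) ^ 2 :=
          Finset.sum_sq_le_sq_sum_of_nonneg fun j _ => abs_nonneg _
      _ ≤ (4 * R) ^ 2 := by gcongr
      _ ≤ _ := by linarith

theorem IsPredictive.refit (hp0 : 0 < p) (hp1 : p < 1) (hM : 1 ≤ M)
    (hn : Tendsto (fun k => (E k).n) atTop atTop) (hε : ∀ k, (E k).IsNoise σ (ε k))
    (hb : IsPredictive E ξ b) {δ : ℝ} (hδ : 0 < δ)
    (hvar : ∀ᶠ k in atTop, δ ≤ sizeVariance (E k).G) {r : ∀ k, (E k).Ω → Bool → Fin 2 → ℝ}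
    (hr : ∀ k, (E k).IsRefit α ξ (ε k) (b k) (r k)) : IsPredictive E ξ r := by
  obtain ⟨κ, hκ, hE⟩ := exists_highProb_le_meanSq (M := M) hp0 hp1 hM hδ
  have hRE := hE E hn hvar
  obtain ⟨B, -, hb⟩ := hb
  -- If ρ were dropped, the error would have first coordinate -ξ, hence mean square at least κξ²,
  -- against a prediction error of at most κξ²/2.
  have hsel : ∀ a, HighProb E fun k ω => ξ a ≠ 0 → b k ω a 0 ≠ 0 := fun a => by
    by_cases hξ : ξ a = 0
    · exact highProb_of_eventually (Eventually.of_forall fun k => ae_of_all _ fun ω h =>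
        (h hξ).elim)
    · have hv : 0 < κ * ξ a ^ 2 / 2 := by positivity
      refine (hRE.and (hb _ hv)).mono' (Eventually.of_forall fun k ω h _ h0 => ?_)
      have h1 := (h.1 a (b k ω a - slopes ξ a)).trans (h.2 a).1
      rw [Fin.sum_univ_two] at h1
      simp only [Pi.sub_apply, slopes, h0, Matrix.cons_val_zero, Matrix.cons_val_one] at h1
      have h2 : 0 ≤ κ * (b k ω a 1 - 0) ^ 2 := by positivity
      linarith
  refine ⟨1, one_pos, fun v hv => HighProb.all fun a => ?_⟩
  -- From κQ ≤ V ≤ 2γ(1 + Q), the condition 4γ ≤ κ yields Q ≤ 1, and then 4γ ≤ v yields V ≤ v.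
  obtain ⟨γ, hγ, hγκ, hγv⟩ := exists_pos_mul_le (A := 4) (B := 4) (by norm_num) (by norm_num)
    hκ hv
  have hnoise : HighProb E fun k ω => ∀ j,
      |∑ i, armWeight (E k).G a j i ((E k).assignment ω) * ε k i ω| ≤
        γ * armCard ((E k).assignment ω) a :=
    HighProb.all fun j => highProb_abs_noise_le_mul_armCard hp0 hp1 hn hε
      (fun k => armWeight (E k).G a j) (by positivity : (0 : ℝ) ≤ 2 * M)
      (fun k => abs_armWeight_le (E k).cliques a j) a hγ
  refine (((hnoise.and (highProb_armCard_pos hp0 hp1 hn)).and hRE).and (hsel a)).mono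
    (Eventually.of_forall fun k => ?_)
  filter_upwards [hr k] with ω hω h
  obtain ⟨⟨⟨h1, h2⟩, h3⟩, h4⟩ := h
  have hsupp : ∀ j, j ∉ {j | b k ω a j ≠ 0} → slopes ξ a j = 0 := fun j hj => by
    fin_cases j
    · by_contra hne
      exact hj (h4 (by simpa [slopes] using hne))
    · simp [slopes]
  have h5 := (hω a).meanSq_le hsupp (h2 a)
    (fun i => response_outcome α ξ (fun i => ε k i ω) (h2 a) i) (γ := γ)
    (fun j => by rw [sum_design_mul_response _ (h2 a)]; exact h1 j)
  have h6 := h3 a (r k ω a - slopes ξ a)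
  set V := meanSq (design (E k).G ((E k).assignment ω) a) (r k ω a - slopes ξ a)
  have h7 : ∑ j, |r k ω a j - slopes ξ a j| ≤ 1 + ∑ j, (r k ω a - slopes ξ a) j ^ 2 := by
    simp only [Fin.sum_univ_two, Pi.sub_apply]
    rw [← sq_abs (r k ω a 0 - slopes ξ a 0), ← sq_abs (r k ω a 1 - slopes ξ a 1)]
    nlinarith [sq_nonneg (|r k ω a 0 - slopes ξ a 0| - 1 / 2),
      sq_nonneg (|r k ω a 1 - slopes ξ a 1| - 1 / 2)]
  have hQ0 : 0 ≤ ∑ j, (r k ω a - slopes ξ a) j ^ 2 := Finset.sum_nonneg fun j _ => sq_nonneg _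
  set Q := ∑ j, (r k ω a - slopes ξ a) j ^ 2
  have h8 : V ≤ 2 * γ * (1 + Q) := h5.trans (by gcongr)
  have h9 : Q ≤ 1 := by
    have h10 : 4 * γ * (1 + Q) ≤ κ * (1 + Q) := by gcongr
    refine le_of_mul_le_mul_left ?_ hκ
    linarith
  refine ⟨h8.trans ?_, h9⟩
  have : 2 * γ * (1 + Q) ≤ 2 * γ * (1 + 1) := by gcongr
  linarith

end Asymptotics

end NetExp

end

theorem proposition3 (p : ℝ) (hp0 : 0 < p) (hp1 : p < 1) (M : ℕ) (hM : 3 ≤ M) :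
    -- the restricted eigenvalue condition over `{ρ}`, in both arms
    (∀ δ : ℝ, 0 < δ → ∃ κ : ℝ, 0 < κ ∧
      ∀ E : ℕ → Experiment.{u} p M, Tendsto (fun k => (E k).n) atTop atTop →
        (∀ᶠ k in atTop, δ ≤ sizeVariance (E k).G) →
        Tendsto (fun k => (E k).P {ω | ∀ a : Bool,
          SatisfiesRE (design (E k).G ((E k).assignment ω) a) {0} κ 3}) atTop (𝓝 1)) ∧
    -- consistency
    (∀ E : ℕ → Experiment.{u} p M, Tendsto (fun k => (E k).n) atTop atTop →
      ∀ (α ξ : Bool → ℝ) (σ : ℝ) (ε : ∀ k, Fin (E k).n → (E k).Ω → ℝ),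
        (∀ k, (E k).IsNoise σ (ε k)) →
      ∀ lam : Bool → ℕ → ℝ,
        (∀ a m, 0 < lam a m) →
        (∀ a, Tendsto (lam a) atTop (𝓝 0)) →
        (∀ a, Tendsto (fun m : ℕ => √(m : ℝ) * lam a m) atTop atTop) →
      ∀ b : ∀ k, (E k).Ω → Bool → Fin 2 → ℝ,
        (∀ k, (E k).IsLassoFit α ξ (ε k) lam (b k)) →
        -- the LASSO coefficients
        (IsConsistent E (fun k => (E k).tauHat α ξ (ε k) (b k))
            (fun k => (E k).gate α ξ (ε k)) ∧
          (α true = α false →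
            IsConsistent E (fun k => (E k).tauHatSlopes (b k))
              (fun k => (E k).gate α ξ (ε k)))) ∧
        -- least squares on the features selected by the LASSO
        (∀ δ : ℝ, 0 < δ → (∀ᶠ k in atTop, δ ≤ sizeVariance (E k).G) →
          ∀ r : ∀ k, (E k).Ω → Bool → Fin 2 → ℝ,
            (∀ k, (E k).IsRefit α ξ (ε k) (b k) (r k)) →
            IsConsistent E (fun k => (E k).tauHat α ξ (ε k) (r k))
                (fun k => (E k).gate α ξ (ε k)) ∧
              (α true = α false →
                IsConsistent E (fun k => (E k).tauHatSlopes (r k))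
                  (fun k => (E k).gate α ξ (ε k))))) := by
  have hM1 : 1 ≤ M := by omega
  refine ⟨fun δ hδ => ?_, fun E hn α ξ σ ε hε lam hpos hzero hlam b hb => ?_⟩
  · obtain ⟨κ, hκ, h⟩ := exists_highProb_le_meanSq hp0 hp1 hM1 hδ
    refine ⟨κ, hκ, fun E hn hvar => HighProb.tendsto_one ?_⟩
    -- The cone constraint is discarded, since the lower bound holds for every Δ.
    exact (h E hn hvar).mono' (Eventually.of_forall fun k ω hω a Δ _ => hω a Δ)
  · have hP := isPredictive_of_isLassoFit hp0 hp1 hn hε hpos hzero hlam hb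
    refine ⟨⟨hP.isConsistent_tauHat hp0 hp1 hM1 hn hε,
      hP.isConsistent_tauHatSlopes hp0 hp1 hM1 hn⟩, fun δ hδ hvar r hr => ?_⟩
    have hR := hP.refit hp0 hp1 hM1 hn hε hδ hvar hr
    exact ⟨hR.isConsistent_tauHat hp0 hp1 hM1 hn hε,
      hR.isConsistent_tauHatSlopes hp0 hp1 hM1 hn⟩
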